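/- **Setting.** Let $\ell\in\{0,1,2,\dots\}\cup\{\infty\}$, and let $X$ be the minimal continuous-time Markov process on the states $(m,i)$ with level $m\in\{\dots,-2,-1,0\}$ and phase $0\le i\le\ell$ ($i<\infty$), whose generator $Q$ is level-homogeneous and skip-free to the left: from level $k$ to level $l$ the rates are given by a matrix $D=(d_{ij})$ if $l=k-1$; by $W=(w_{ij})$ if $l=k<0$; by $U^{l-k}=(u^{l-k}_{ij})$ if $k<l<0$; by $W'$ if $k=l=0$; by $U^{(-k)'}$ if $k<l=0$; and are $0$ if $l<k-1$. Assume that $Q$ is a stable, conservative $q$-matrix (finite entries, nonnegative off-diagonal entries, zero row sums), that it is irreducible, and that $D+W+\sum_{s\ge1}U^s$ has zero row sums as well (equivalently, $U^{k'}$ has the same row sums as $\sum_{s\ge k}U^s$ for every $k\ge 1$). Assume that $X$ has a stationary distribution $\pi$ (a probability vector with $\pi P_t=\pi$ for all $t\ge0$, where $P_t$ is the transition function of $X$). A state $x\in M$ is an *exit state* of a set $M$ of states if $\sum_{z\notin M}q_{yz}=0$ for all $y\in M\setminus\{x\}$ and $\sum_{z\notin M}q_{xz}>0$. Assume that for every $m\le0$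 the state $(m,0)$ is an exit state of the super-level set $\{(k,i):k\ge m\}$. For $0\le i,j\le\ell$, $m<0$ and $k<m$ put $$\check q_{ij}=w_{ij}+\sum_{s=1}^\infty\sum_{r=0}^\ell u^s_{ir}\frac{d_{0j}}{\sum_{v=0}^\ell d_{0v}},\qquad \check a_{(k,i)(m,j)}=u^{m-k}_{ij}+\sum_{s=m+1-k}^\infty\sum_{r=0}^\ell u^s_{ir}\frac{d_{0j}}{\sum_{v=0}^\ell d_{0v}} .$$ **Theorem.** The matrix $\check Q=(\check q_{ij})$ has a two-sided inverse $\check Q^{-1}=-\check T$, where $\check T_{ij}<\infty$ is the expected total time that the minimal process with $q$-matrix $\check Q$, started in $i$, spends in $j$; if $\ell<\infty$, it is the only two-sided inverse of $\check Q$. For every level $m<0$ the entries of $R:=-\check A\check Q^{-1}$, where $\check A=(\check a_{(k,i)(m,j)})_{k<m}$, are given by absolutely convergent sums, and $$\pi_m=\tilde\pi_{m-1}R ,$$ where $\pi_m=(\pi_{(m,j)})_{0\le j\le\ell}$ and $\tilde\pi_{m-1}=(\pi_{(k,i)})_{k\le m-1,\,0\le i\le\ell}$ is the restriction of $\pi$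 to the sub-level set of levels at most $m-1$. -/

import Mathlib

open scoped ENNReal

/-! ### Continuous-time Markov processes on a countable state space, given by a `q`-matrix -/

section QMatrix

variable {S : Type}

/-- A stable, conservative `q`-matrix: the entries are real (so all rates are finite), the
off-diagonal entries are nonnegative, and every row sums to zero. -/
def IsConservativeQMatrix (q : S → S → ℝ) : Prop :=
  (∀ x y, x ≠ y → 0 ≤ q x y) ∧ ∀ x, HasSum (fun y => q x y) 0

/-- Every state can be reached from every state by jumps of positive rate. -/
def IsIrreducibleQMatrix (q : S → S → ℝ) : Prop :=
  ∀ x y, Relation.ReflTransGen (fun a b => a ≠ b ∧ 0 < q a b) x y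

open Classical in
/-- Feller's iteration: the probability that the process with (possibly non-conservative)
`q`-matrix `q`, started in `x`, is in `y` at time `t` after fewer than `n` jumps. -/
noncomputable def transitionIter (q : S → S → ℝ) : ℕ → ℝ → S → S → ℝ≥0∞
  | 0, _, _, _ => 0
  | n + 1, t, x, y =>
      (if x = y then ENNReal.ofReal (Real.exp (q x x * t)) else 0) +
        ∫⁻ s in Set.Icc 0 t, ENNReal.ofReal (Real.exp (q x x * s)) *
          ∑' z, (if z = x then 0 else ENNReal.ofReal (q x z)) * transitionIter q n (t - s) z y

/-- The transition function `P_t(x,y)` of the minimal process with `q`-matrix `q`. -/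
noncomputable def minimalTransition (q : S → S → ℝ) (t : ℝ) (x y : S) : ℝ≥0∞ :=
  ⨆ n, transitionIter q n t x y

/-- The expected total time `∫₀^∞ P_t(x,y) dt` that the minimal process with `q`-matrix `q`,
started in `x`, spends in `y`. -/
noncomputable def meanSojourn (q : S → S → ℝ) (x y : S) : ℝ≥0∞ :=
  ∫⁻ t in Set.Ioi (0 : ℝ), minimalTransition q t x y

/-- `p` is a stationary distribution of the minimal process with `q`-matrix `q`. -/
def IsStationaryDistribution (q : S → S → ℝ) (p : S → ℝ) : Prop :=
  (∀ x, 0 ≤ p x) ∧ HasSum p 1 ∧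
    ∀ t : ℝ, 0 ≤ t → ∀ y,
      ∑' x, ENNReal.ofReal (p x) * minimalTransition q t x y = ENNReal.ofReal (p y)

/-- `x` is an exit state for the set `M`: it is the only state of `M` from which `M` can be
left by one jump. -/
def IsExitState (q : S → S → ℝ) (M : Set S) (x : S) : Prop :=
  x ∈ M ∧ (∀ y ∈ M, y ≠ x → ∑' z : (Mᶜ : Set S), q y z = 0) ∧
    0 < ∑' z : (Mᶜ : Set S), q x z

open Classical in
/-- `N` is a two-sided inverse of the (finite or countably infinite) matrix `A`. -/
def IsMatrixInverse (A N : S → S → ℝ) : Prop :=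
  (∀ i j, HasSum (fun k => A i k * N k j) (if i = j then 1 else 0)) ∧
    ∀ i j, HasSum (fun k => N i k * A k j) (if i = j then 1 else 0)

/-- The inverse of the `q`-matrix of a transient process: minus the matrix of expected sojourn
times. (For a finite matrix this is the usual inverse; for an infinite one it selects the
probabilistically meaningful inverse.) -/
noncomputable def qInverse (q : S → S → ℝ) (i j : S) : ℝ :=
  -(meanSojourn q i j).toReal

end QMatrix

/-! ### Level-homogeneous quasi-skip-free processes -/

/-- The phases `0, 1, …, ℓ`; `ℓ = ⊤` means countably many phases. -/
abbrev Phase (ℓ : ℕ∞) : Type := {i : ℕ // (i : ℕ∞) ≤ ℓ}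

/-- The phase `0`. -/
def Phase.zero (ℓ : ℕ∞) : Phase ℓ := ⟨0, by simp⟩

/-- The states `(m, i)`, with level `m ∈ {…, -2, -1, 0}` and phase `i ∈ {0, …, ℓ}`. -/
abbrev QSFState (ℓ : ℕ∞) : Type := {m : ℤ // m ≤ 0} × Phase ℓ

/-- The blocks of a level-homogeneous generator that is skip-free to the left. `U s` and `U' s`
are used for `s ≥ 1` only; `W'` and `U'` are the boundary blocks of transitions to level `0`. -/
structure QSFBlocks (ℓ : ℕ∞) where
  D : Phase ℓ → Phase ℓ → ℝ
  W : Phase ℓ → Phase ℓ → ℝ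
  U : ℕ → Phase ℓ → Phase ℓ → ℝ
  W' : Phase ℓ → Phase ℓ → ℝ
  U' : ℕ → Phase ℓ → Phase ℓ → ℝ

namespace QSFBlocks

variable {ℓ : ℕ∞} (B : QSFBlocks ℓ)

/-- The generator: from level `k` to level `l` the rates are given by `D` if `l = k - 1`; by `W`
if `l = k < 0`; by `U^{l-k}` if `k < l < 0`; by `W'` if `k = l = 0`; by `U'^{-k}` if
`k < l = 0`; and there are no transitions if `l < k - 1`. -/
def generator (x y : QSFState ℓ) : ℝ :=
  if y.1.1 < x.1.1 - 1 then 0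
  else if y.1.1 = x.1.1 - 1 then B.D x.2 y.2
  else if y.1.1 = 0 then
    if x.1.1 = 0 then B.W' x.2 y.2 else B.U' (-x.1.1).toNat x.2 y.2
  else if y.1.1 = x.1.1 then B.W x.2 y.2
  else B.U (y.1.1 - x.1.1).toNat x.2 y.2

/-- The homogeneous part is conservative: `D + W + U^1 + U^2 + ⋯` has row sums zero. -/
def HomogeneousConservative : Prop :=
  ∀ i, HasSum (fun s : ℕ => ∑' r, B.U (s + 1) i r) (-((∑' r, B.D i r) + ∑' r, B.W i r))

/-- The super-level set of all states of level at least `m`. -/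
def superLevel (ℓ : ℕ∞) (m : ℤ) : Set (QSFState ℓ) := {x | m ≤ x.1.1}

/-- The sub-level set of all states of level at most `m`. -/
def subLevel (ℓ : ℕ∞) (m : ℤ) : Set (QSFState ℓ) := {x | x.1.1 ≤ m}

/-- `d_{0j} / ∑_v d_{0v}`. -/
noncomputable def entrance (j : Phase ℓ) : ℝ :=
  B.D (Phase.zero ℓ) j / ∑' v, B.D (Phase.zero ℓ) v

/-- `q̌_{ij} = w_{ij} + ∑_{s ≥ 1} ∑_r u^s_{ir} d_{0j} / ∑_v d_{0v}`. -/
noncomputable def Qcheck (i j : Phase ℓ) : ℝ :=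
  B.W i j + ∑' s : ℕ, ∑' r, B.U (1 + s) i r * B.entrance j

/-- `ǎ_{(k,i)(m,j)} = u^{m-k}_{ij} + ∑_{s ≥ m+1-k} ∑_r u^s_{ir} d_{0j} / ∑_v d_{0v}` for
`k ≤ m - 1`. -/
noncomputable def Acheck (m : ℤ) (x : subLevel ℓ (m - 1)) (j : Phase ℓ) : ℝ :=
  B.U (m - x.1.1.1).toNat x.1.2 j +
    ∑' s : ℕ, ∑' r, B.U ((m + 1 - x.1.1.1).toNat + s) x.1.2 r * B.entrance j

/-- `R = -Ǎ Q̌⁻¹`. -/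
noncomputable def rateMatrix (m : ℤ) (x : subLevel ℓ (m - 1)) (j : Phase ℓ) : ℝ :=
  -∑' i, B.Acheck m x i * qInverse B.Qcheck i j

end QSFBlocks

/-! ### Green functions of jump rates -/

section Green

open Classical

variable {S : Type*}

/-! A stationary distribution makes the irreducible process recurrent. An excursion above level `m`
therefore almost surely comes back to the levels up to `m`. Since the process is skip-free to the
left and `(m+1,0)` is an exit state, it comes back by a jump from `(m+1,0)` and lands in `(m,j)`
with probability `entrance j`, wherever it began. Cutting these excursions out leaves a process
whose rates are `Q̌` within level `m` and `Ǎ` from the lower levels into level `m`. Invariance then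
reads `π_m Q̌ + π̃_{m-1} Ǎ = 0`.

With infinitely many phases one cannot simply multiply this equation by an inverse, so minimality
takes over. Sojourn times are treated as Green functions with values in `ℝ≥0∞`, the minimal
solutions of the backward and forward equations; Laplace transforms identify them with resolvents of
the minimal process. The Green function `Ť` of `Q̌` is finite because `Q̌` is killed at rate
`downRate` in phase `0`, which is reachable from every phase (`path_Qcheck`).

Minimality gives `π̃_{m-1} Ǎ Ť ≤ π_m` (`levelMeasure_le`). For equality (`eq_levelMeasure`), take
the measure that is `π` below level `m`, `π̃_{m-1} Ǎ Ť` on it, and above it the sojourn measure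
generated by the upward flow. It is superinvariant and dominated by `π`, hence invariant by
recurrence. It agrees with `π` below level `m`, hence everywhere by irreducibility. -/

lemma tsum_iSup_nat_of_monotone (f : ℕ → S → ℝ≥0∞) (hf : Monotone f) :
    ∑' z, ⨆ n, f n z = ⨆ n, ∑' z, f n z := by
  let _ : MeasurableSpace S := ⊤
  have : MeasurableSingletonClass S := ⟨fun _ => trivial⟩
  simp only [← MeasureTheory.lintegral_count]
  exact MeasureTheory.lintegral_iSup (fun n => measurable_from_top) hf

/-- Mean sojourn times, up to the `n`-th jump, of the process which jumps from `x` to `z` at rate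
`a x z` and leaves `x` at total rate `q x`. -/
noncomputable def greenIter (a : S → S → ℝ≥0∞) (q : S → ℝ≥0∞) : ℕ → S → S → ℝ≥0∞
  | 0, _, _ => 0
  | n + 1, x, y => ((if x = y then 1 else 0) + ∑' z, a x z * greenIter a q n z y) * (q x)⁻¹

/-- The Green function: the minimal nonnegative solution of the backward equation. -/
noncomputable def green (a : S → S → ℝ≥0∞) (q : S → ℝ≥0∞) (x y : S) : ℝ≥0∞ :=
  ⨆ n, greenIter a q n x y

variable (a : S → S → ℝ≥0∞) (q : S → ℝ≥0∞)

lemma greenIter_succ (n : ℕ) (x y : S) : greenIter a q (n + 1) x y =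
    ((if x = y then 1 else 0) + ∑' z, a x z * greenIter a q n z y) * (q x)⁻¹ := rfl

lemma greenIter_le_succ (n : ℕ) : ∀ x y, greenIter a q n x y ≤ greenIter a q (n + 1) x y := by
  induction n with
  | zero => intro x y; exact zero_le
  | succ n ih =>
    intro x y
    rw [greenIter_succ, greenIter_succ a q (n + 1)]
    gcongr with z
    exact ih z y

lemma greenIter_mono (x y : S) : Monotone fun n => greenIter a q n x y :=
  monotone_nat_of_le_succ fun n => greenIter_le_succ a q n x y

lemma greenIter_le_green (n : ℕ) (x y : S) : greenIter a q n x y ≤ green a q x y :=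
  le_iSup (fun n => greenIter a q n x y) n

lemma green_eq_iSup_succ (x y : S) : green a q x y = ⨆ n, greenIter a q (n + 1) x y :=
  ((greenIter_mono a q x y).iSup_nat_add 1).symm

lemma greenIter_antitone_rate {q' : S → ℝ≥0∞} (h : ∀ x, q x ≤ q' x) (n : ℕ) :
    ∀ x y, greenIter a q' n x y ≤ greenIter a q n x y := by
  induction n with
  | zero => intro x y; exact le_rfl
  | succ n ih =>
    intro x y
    rw [greenIter_succ, greenIter_succ]
    gcongr with z
    · exact ih z y
    · exact h x

lemma green_antitone_rate {q' : S → ℝ≥0∞} (h : ∀ x, q x ≤ q' x) (x y : S) :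
    green a q' x y ≤ green a q x y :=
  iSup_mono fun n => greenIter_antitone_rate a q h n x y

variable {a q}

lemma greenIter_succ_mul (h0 : ∀ x, q x ≠ 0) (ht : ∀ x, q x ≠ ⊤) (n : ℕ) (x y : S) :
    q x * greenIter a q (n + 1) x y =
      (if x = y then 1 else 0) + ∑' z, a x z * greenIter a q n z y := by
  rw [greenIter_succ, mul_comm, mul_assoc, ENNReal.inv_mul_cancel (h0 x) (ht x), mul_one]

/-- The backward equation. -/
lemma green_backward (h0 : ∀ x, q x ≠ 0) (ht : ∀ x, q x ≠ ⊤) (x y : S) :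
    q x * green a q x y = (if x = y then 1 else 0) + ∑' z, a x z * green a q z y := by
  rw [green_eq_iSup_succ, ENNReal.mul_iSup]
  simp only [greenIter_succ_mul h0 ht]
  rw [← ENNReal.add_iSup, ← tsum_iSup_nat_of_monotone]
  · simp only [green, ENNReal.mul_iSup]
  · intro m n hmn z
    exact mul_le_mul_right (greenIter_mono a q z y hmn) _

/-- Both recursions sum over the same paths. The definition splits off the first jump; the induction
trades this for splitting off the last one. -/
lemma greenIter_succ_mul_forward (h0 : ∀ x, q x ≠ 0) (ht : ∀ x, q x ≠ ⊤) (n : ℕ) :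
    ∀ x y, greenIter a q (n + 1) x y * q y =
      (if x = y then 1 else 0) + ∑' z, greenIter a q n x z * a z y := by
  induction n with
  | zero =>
    intro x y
    simp only [greenIter, mul_zero, tsum_zero, add_zero, zero_mul]
    by_cases h : x = y
    · subst h; simp [ENNReal.inv_mul_cancel (h0 x) (ht x)]
    · simp [h]
  | succ n ih =>
    intro x y
    have e : greenIter a q (n + 2) x y * q y = ((if x = y then 1 else 0) * q y
        + ∑' z, a x z * (greenIter a q (n + 1) z y * q y)) * (q x)⁻¹ := by
      rw [greenIter_succ, mul_right_comm, add_mul, ← ENNReal.tsum_mul_right]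
      simp only [mul_assoc]
    rw [e]
    simp only [ih]
    simp only [greenIter_succ a q n, mul_add, ENNReal.tsum_add, add_mul,
      ← ENNReal.tsum_mul_left, ← ENNReal.tsum_mul_right]
    rw [ENNReal.tsum_comm (f := fun z w => a x z * (greenIter a q n z w * a w y) * (q x)⁻¹)]
    congr 1
    · by_cases h : x = y
      · subst h; simp [ENNReal.mul_inv_cancel (h0 x) (ht x)]
      · simp [h]
    · congr 1
      · rw [tsum_eq_single y, tsum_eq_single x]
        · simp only [if_true]; ring
        · intro z hz; simp [hz.symm]
        · intro z hz; simp [hz]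
      · refine tsum_congr fun w => tsum_congr fun z => ?_
        ring

/-- The forward equation. -/
lemma green_forward (h0 : ∀ x, q x ≠ 0) (ht : ∀ x, q x ≠ ⊤) (x y : S) :
    green a q x y * q y = (if x = y then 1 else 0) + ∑' z, green a q x z * a z y := by
  rw [green_eq_iSup_succ, ENNReal.iSup_mul]
  simp only [greenIter_succ_mul_forward h0 ht]
  rw [← ENNReal.add_iSup, ← tsum_iSup_nat_of_monotone]
  · simp only [green, ENNReal.iSup_mul]
  · intro m n hmn z
    exact mul_le_mul_left (greenIter_mono a q x z hmn) _

/-- The columns of the Green function are minimal. -/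
lemma mul_green_le_of_superharmonic (h0 : ∀ x, q x ≠ 0) (ht : ∀ x, q x ≠ ⊤) {v : S → ℝ≥0∞}
    {c : ℝ≥0∞} {y : S} (hv : ∀ x, (if x = y then c else 0) + ∑' z, a x z * v z ≤ q x * v x)
    (x : S) : c * green a q x y ≤ v x := by
  rw [green, ENNReal.mul_iSup]
  refine iSup_le fun n => ?_
  induction n generalizing x with
  | zero => simp [greenIter]
  | succ n ih =>
    refine (ENNReal.mul_le_mul_iff_right (h0 x) (ht x)).1 (le_trans ?_ (hv x))
    rw [mul_left_comm, greenIter_succ_mul h0 ht, mul_add, ← ENNReal.tsum_mul_left]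
    refine add_le_add (by split_ifs <;> simp) (ENNReal.tsum_le_tsum fun z => ?_)
    rw [mul_left_comm]
    gcongr
    exact ih z

/-- The rows of the Green function are minimal. -/
lemma tsum_mul_green_le_of_superinvariant (h0 : ∀ x, q x ≠ 0) (ht : ∀ x, q x ≠ ⊤)
    {b v : S → ℝ≥0∞} (hv : ∀ y, b y + ∑' x, v x * a x y ≤ v y * q y) (y : S) :
    ∑' x, b x * green a q x y ≤ v y := by
  simp only [green, ENNReal.mul_iSup]
  rw [tsum_iSup_nat_of_monotone]
  swap
  · intro m n hmn z
    exact mul_le_mul_right (greenIter_mono a q z y hmn) _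
  refine iSup_le fun n => ?_
  induction n generalizing y with
  | zero => simp [greenIter]
  | succ n ih =>
    refine (ENNReal.mul_le_mul_iff_left (h0 y) (ht y)).1 (le_trans ?_ (hv y))
    rw [← ENNReal.tsum_mul_right]
    simp only [mul_assoc, greenIter_succ_mul_forward h0 ht, mul_add, ENNReal.tsum_add,
      ← ENNReal.tsum_mul_left]
    rw [ENNReal.tsum_comm]
    gcongr with z
    · rw [tsum_eq_single y]
      · simp
      · intro z hz; simp [hz]
    · simp only [← mul_assoc]
      rw [ENNReal.tsum_mul_right]
      gcongr
      exact ih z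

lemma tsum_mul_green_forward (h0 : ∀ x, q x ≠ 0) (ht : ∀ x, q x ≠ ⊤) (b : S → ℝ≥0∞) (y : S) :
    (∑' x, b x * green a q x y) * q y =
      b y + ∑' z, (∑' x, b x * green a q x z) * a z y := by
  rw [← ENNReal.tsum_mul_right]
  simp only [mul_assoc, green_forward h0 ht, mul_add, ENNReal.tsum_add, ← ENNReal.tsum_mul_left,
    ← ENNReal.tsum_mul_right]
  rw [ENNReal.tsum_comm, tsum_eq_single y]
  · simp
  · intro z hz; simp [hz]

/-! ### Maximum principle, recurrence and irreducibility -/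

lemma green_le_diag (h0 : ∀ x, q x ≠ 0) (ht : ∀ x, q x ≠ ⊤) (hq : ∀ x, ∑' z, a x z ≤ q x)
    (x y : S) : green a q x y ≤ green a q y y := by
  refine iSup_le fun n => ?_
  induction n generalizing x with
  | zero => simp [greenIter]
  | succ n ih =>
    -- Off the diagonal there is no source term: the next iterate averages earlier values, with
    -- weights of total mass at most one.
    by_cases h : x = y
    · subst h; exact greenIter_le_green a q _ x x
    · refine (ENNReal.mul_le_mul_iff_right (h0 x) (ht x)).1 ?_
      rw [greenIter_succ_mul h0 ht, if_neg h, zero_add]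
      calc ∑' z, a x z * greenIter a q n z y ≤ ∑' z, a x z * green a q y y := by
            gcongr with z; exact ih z
        _ = (∑' z, a x z) * green a q y y := ENNReal.tsum_mul_right
        _ ≤ _ := by gcongr; exact hq x

/-- A defect `δ > 0` at `y` acts as a point source, so minimality gives `δ * green a q y y ≤ v y <
⊤`, against recurrence. -/
lemma superharmonic_eq_of_recurrent (h0 : ∀ x, q x ≠ 0) (ht : ∀ x, q x ≠ ⊤)
    (hrec : ∀ x, green a q x x = ⊤) {v : S → ℝ≥0∞} (hvt : ∀ x, v x ≠ ⊤)
    (hv : ∀ x, ∑' z, a x z * v z ≤ q x * v x) (y : S) :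
    ∑' z, a y z * v z = q y * v y := by
  refine le_antisymm (hv y) ?_
  rw [← tsub_eq_zero_iff_le]
  by_contra hc
  have h : (q y * v y - ∑' z, a y z * v z) * green a q y y ≤ v y := by
    refine mul_green_le_of_superharmonic h0 ht (fun x => ?_) y
    split_ifs with hxy
    · subst hxy; rw [tsub_add_cancel_of_le (hv x)]
    · rw [zero_add]; exact hv x
  rw [hrec y, ENNReal.mul_top hc] at h
  exact hvt y (top_le_iff.1 h)

lemma superinvariant_eq_of_recurrent (h0 : ∀ x, q x ≠ 0) (ht : ∀ x, q x ≠ ⊤)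
    (hrec : ∀ x, green a q x x = ⊤) {v : S → ℝ≥0∞} (hvt : ∀ x, v x ≠ ⊤)
    (hv : ∀ y, ∑' x, v x * a x y ≤ v y * q y) (y : S) :
    ∑' x, v x * a x y = v y * q y := by
  refine le_antisymm (hv y) ?_
  rw [← tsub_eq_zero_iff_le]
  by_contra hc
  have h := tsum_mul_green_le_of_superinvariant h0 ht (v := v)
    (b := fun z => if z = y then v y * q y - ∑' x, v x * a x y else 0) (fun z => by
      split_ifs with hz
      · subst hz; rw [tsub_add_cancel_of_le (hv z)]
      · rw [zero_add]; exact hv z) y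
  have h2 := (ENNReal.le_tsum y).trans h
  rw [if_pos rfl, hrec y, ENNReal.mul_top hc] at h2
  exact hvt y (top_le_iff.1 h2)

/-- A finite harmonic function bounded below by another one which it touches. -/
lemma harmonic_eq_of_eq_at {v w : S → ℝ≥0∞} (ht : ∀ x, q x ≠ ⊤) (hwt : ∀ x, w x ≠ ⊤)
    (hvw : ∀ x, v x ≤ w x) (hv : ∀ x, ∑' z, a x z * v z = q x * v x)
    (hw : ∀ x, ∑' z, a x z * w z = q x * w x)
    {x y : S} (hxy : Relation.ReflTransGen (fun b c => a b c ≠ 0 ∧ a b c ≠ ⊤) x y)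
    (hx : v x = w x) : v y = w y := by
  induction hxy with
  | refl => exact hx
  | @tail b c _ hbc ih =>
    -- A strict inequality at `c` would pass through the positive finite rate `a b c` to the
    -- equations at `b`, where both sides agree.
    by_contra hne
    have h := ENNReal.tsum_lt_tsum (f := fun z => a b z * v z) (g := fun z => a b z * w z) (i := c)
      (by rw [hv b]; exact ENNReal.mul_ne_top (ht b) (ne_top_of_le_ne_top (hwt b) (hvw b)))
      (fun z => mul_le_mul_right (hvw z) _)
      (ENNReal.mul_lt_mul_right hbc.1 hbc.2 (lt_of_le_of_ne (hvw c) hne))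
    rw [hv, hw, ih] at h
    exact lt_irrefl _ h

/-- An invariant measure bounded below by another one which it touches. -/
lemma invariant_eq_of_eq_at {v w : S → ℝ≥0∞} (ht : ∀ x, q x ≠ ⊤) (hwt : ∀ x, w x ≠ ⊤)
    (hvw : ∀ x, v x ≤ w x) (hv : ∀ y, ∑' x, v x * a x y = v y * q y)
    (hw : ∀ y, ∑' x, w x * a x y = w y * q y)
    {x y : S} (hxy : Relation.ReflTransGen (fun b c => a b c ≠ 0 ∧ a b c ≠ ⊤) x y)
    (hy : v y = w y) : v x = w x := by
  induction hxy using Relation.ReflTransGen.head_induction_on with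
  | refl => exact hy
  | @head b c hbc _ ih =>
    by_contra hne
    have h := ENNReal.tsum_lt_tsum (f := fun z => v z * a z c) (g := fun z => w z * a z c) (i := b)
      (by rw [hv c]; exact ENNReal.mul_ne_top (ne_top_of_le_ne_top (hwt c) (hvw c)) (ht c))
      (fun z => mul_le_mul_left (hvw z) _)
      (ENNReal.mul_lt_mul_left hbc.1 hbc.2 (lt_of_le_of_ne (hvw b) hne))
    rw [hv, hw, ih] at h
    exact lt_irrefl _ h

lemma invariant_ne_zero {v : S → ℝ≥0∞}
    (hv : ∀ y, ∑' x, v x * a x y = v y * q y) {x y : S}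
    (hxy : Relation.ReflTransGen (fun b c => a b c ≠ 0 ∧ a b c ≠ ⊤) x y) (hx : v x ≠ 0) :
    v y ≠ 0 := by
  induction hxy with
  | refl => exact hx
  | @tail b c _ hbc ih =>
    intro h0
    have h := hv c
    rw [h0, zero_mul, ENNReal.tsum_eq_zero] at h
    exact (mul_ne_zero ih hbc.1) (h b)

/-- Finiteness of the Green function spreads along paths, backwards from the target. -/
lemma green_ne_top_of_path (h0 : ∀ x, q x ≠ 0) (ht : ∀ x, q x ≠ ⊤) (x : S) {y z : S}
    (hyz : Relation.ReflTransGen (fun b c => a b c ≠ 0) y z) (hz : green a q x z ≠ ⊤) :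
    green a q x y ≠ ⊤ := by
  induction hyz using Relation.ReflTransGen.head_induction_on with
  | refl => exact hz
  | @head b c hbc _ ih =>
    intro hb
    have h := green_forward (a := a) h0 ht x c
    have h1 : green a q x b * a b c ≤ green a q x c * q c := by
      rw [h]
      exact (ENNReal.le_tsum (f := fun z => green a q x z * a z c) b).trans le_add_self
    rw [hb, ENNReal.top_mul hbc] at h1
    exact (ENNReal.mul_ne_top ih (ht c)) (top_le_iff.1 h1)

end Green

/-! ### Laplace transforms of transition functions -/

section Laplace

open Classical MeasureTheory

variable {S : Type}

/-- The off-diagonal rates of a `q`-matrix. -/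
noncomputable def offRate (Q : S → S → ℝ) (x z : S) : ℝ≥0∞ :=
  if z = x then 0 else ENNReal.ofReal (Q x z)

/-- The total rate at which a state is left. -/
noncomputable def exitRate (Q : S → S → ℝ) (x : S) : ℝ≥0∞ := ENNReal.ofReal (-(Q x x))

/-- Extended by zero, this is a convolution on the whole line; Tonelli and translation invariance
separate the factors. -/
lemma lintegral_Ici_convolution {F G : ℝ → ℝ≥0∞} (hF : Measurable F) (hG : Measurable G) :
    ∫⁻ t in Set.Ici 0, ∫⁻ s in Set.Icc 0 t, F s * G (t - s) =
      (∫⁻ s in Set.Ici 0, F s) * ∫⁻ u in Set.Ici 0, G u := by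
  set F' := (Set.Ici (0 : ℝ)).indicator F with hF'
  set G' := (Set.Ici (0 : ℝ)).indicator G with hG'
  have mF : Measurable F' := hF.indicator measurableSet_Ici
  have mG : Measurable G' := hG.indicator measurableSet_Ici
  have h1 : ∀ t, (Set.Ici (0 : ℝ)).indicator (fun t => ∫⁻ s in Set.Icc 0 t, F s * G (t - s)) t =
      ∫⁻ s, F' s * G' (t - s) := by
    intro t
    by_cases ht : 0 ≤ t
    · rw [Set.indicator_of_mem (Set.mem_Ici.2 ht), ← lintegral_indicator measurableSet_Icc]
      refine lintegral_congr fun s => ?_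
      simp only [hF', hG', Set.indicator_apply, Set.mem_Icc, Set.mem_Ici, sub_nonneg]
      by_cases h0 : 0 ≤ s <;> by_cases h2 : s ≤ t <;> simp [h0, h2]
    · rw [Set.indicator_of_notMem (by simpa using ht)]
      symm
      rw [← lintegral_zero (μ := volume) (α := ℝ)]
      refine lintegral_congr fun s => ?_
      simp only [hF', hG', Set.indicator_apply, Set.mem_Ici, sub_nonneg]
      by_cases h0 : 0 ≤ s
      · rw [if_neg (c := s ≤ t) (by linarith), mul_zero]
      · simp [h0]
  rw [← lintegral_indicator measurableSet_Ici, lintegral_congr h1, lintegral_lintegral_swap,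
    ← lintegral_indicator measurableSet_Ici, ← lintegral_indicator measurableSet_Ici,
    ← lintegral_mul_const _ mF]
  · refine lintegral_congr fun s => ?_
    rw [lintegral_const_mul]
    · rw [lintegral_sub_right_eq_self G' s]
    · exact mG.comp (measurable_id.sub_const s)
  · exact ((mF.comp measurable_snd).mul
      (mG.comp (measurable_fst.sub measurable_snd))).aemeasurable

lemma lintegral_Ici_exp_neg {c : ℝ} (hc : 0 ≤ c) :
    ∫⁻ t in Set.Ici (0 : ℝ), ENNReal.ofReal (Real.exp (-c * t)) = (ENNReal.ofReal c)⁻¹ := by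
  rw [setLIntegral_congr Ioi_ae_eq_Ici.symm]
  -- For `c = 0` both sides are `⊤`; this admits absorbing states without discounting.
  rcases hc.eq_or_lt with rfl | hc
  · simp
  · rw [← ofReal_integral_eq_lintegral_ofReal
      (integrableOn_exp_mul_Ioi (by linarith) 0)
      (Filter.Eventually.of_forall fun _ => (Real.exp_pos _).le),
      integral_exp_mul_Ioi (by linarith), ← ENNReal.ofReal_inv_of_pos hc]
    congr 1
    simp

variable (Q : S → S → ℝ)

lemma transitionIter_succ (n : ℕ) (t : ℝ) (x y : S) : transitionIter Q (n + 1) t x y =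
    (if x = y then ENNReal.ofReal (Real.exp (Q x x * t)) else 0) +
      ∫⁻ s in Set.Icc 0 t, ENNReal.ofReal (Real.exp (Q x x * s)) *
        ∑' z, offRate Q x z * transitionIter Q n (t - s) z y := rfl

lemma transitionIter_le_succ (n : ℕ) :
    ∀ t x y, transitionIter Q n t x y ≤ transitionIter Q (n + 1) t x y := by
  induction n with
  | zero => intro t x y; exact zero_le
  | succ n ih =>
    intro t x y
    rw [transitionIter_succ, transitionIter_succ Q (n + 1)]
    gcongr with s z
    exact ih _ z y

lemma transitionIter_mono (t : ℝ) (x y : S) : Monotone fun n => transitionIter Q n t x y :=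
  monotone_nat_of_le_succ fun n => transitionIter_le_succ Q n t x y

lemma measurable_transitionIter [Countable S] (n : ℕ) :
    ∀ x y, Measurable fun t => transitionIter Q n t x y := by
  induction n with
  | zero => intro x y; exact measurable_const
  | succ n ih =>
    intro x y
    simp only [transitionIter_succ]
    refine Measurable.add (by split_ifs <;> fun_prop) ?_
    have h : ∀ t, ∫⁻ s in Set.Icc 0 t, ENNReal.ofReal (Real.exp (Q x x * s)) *
        ∑' z, offRate Q x z * transitionIter Q n (t - s) z y =
        ∫⁻ s, {p : ℝ × ℝ | p.2 ∈ Set.Icc 0 p.1}.indicator (fun p =>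
          ENNReal.ofReal (Real.exp (Q x x * p.2)) *
            ∑' z, offRate Q x z * transitionIter Q n (p.1 - p.2) z y) (t, s) := by
      intro t
      rw [← lintegral_indicator measurableSet_Icc]
      rfl
    simp only [h]
    refine Measurable.lintegral_prod_right' (Measurable.indicator ?_ ?_)
    · refine Measurable.mul (by fun_prop) (Measurable.tsum fun z => ?_)
      exact ((ih z y).comp (measurable_fst.sub measurable_snd)).const_mul _
    · exact (measurableSet_le measurable_const measurable_snd).inter
        (measurableSet_le measurable_snd measurable_fst)

lemma measurable_minimalTransition [Countable S] (x y : S) :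
    Measurable fun t => minimalTransition Q t x y :=
  Measurable.iSup fun n => measurable_transitionIter Q n x y

variable {Q}

/-- Discounting by `exp (-r t)` amounts to killing at rate `r`, so `r` joins the exit rate, and the
convolution in Feller's iteration becomes a product. -/
lemma laplace_transitionIter [Countable S] (hd : ∀ x, Q x x ≤ 0) {r : ℝ} (hr : 0 ≤ r) (n : ℕ) :
    ∀ x y, ∫⁻ t in Set.Ici (0 : ℝ), ENNReal.ofReal (Real.exp (-r * t)) * transitionIter Q n t x y =
      greenIter (offRate Q) (fun x => exitRate Q x + ENNReal.ofReal r) n x y := by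
  induction n with
  | zero => intro x y; simp [transitionIter, greenIter]
  | succ n ih =>
    intro x y
    have hc : 0 ≤ -(Q x x) + r := by have := hd x; linarith
    have hrate : (exitRate Q x + ENNReal.ofReal r)⁻¹ =
        ∫⁻ s in Set.Ici (0 : ℝ), ENNReal.ofReal (Real.exp (-(-(Q x x) + r) * s)) := by
      rw [lintegral_Ici_exp_neg hc, exitRate, ← ENNReal.ofReal_add (by have := hd x; linarith) hr]
    have hexp : ∀ u v : ℝ, ENNReal.ofReal (Real.exp (-r * (u + v))) *
        ENNReal.ofReal (Real.exp (Q x x * u)) =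
        ENNReal.ofReal (Real.exp (-(-(Q x x) + r) * u)) * ENNReal.ofReal (Real.exp (-r * v)) := by
      intro u v
      rw [← ENNReal.ofReal_mul (Real.exp_pos _).le, ← ENNReal.ofReal_mul (Real.exp_pos _).le,
        ← Real.exp_add, ← Real.exp_add]
      congr 2
      ring
    have mG : Measurable fun u : ℝ => ENNReal.ofReal (Real.exp (-r * u)) *
        ∑' z, offRate Q x z * transitionIter Q n u z y :=
      Measurable.mul (by fun_prop)
        (Measurable.tsum fun z => (measurable_transitionIter Q n z y).const_mul _)
    rw [greenIter_succ, add_mul, hrate]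
    simp only [transitionIter_succ, mul_add]
    rw [lintegral_add_left (by split_ifs <;> fun_prop)]
    congr 1
    · split_ifs with h
      · rw [one_mul]
        refine lintegral_congr fun t => ?_
        simpa using hexp t 0
      · simp
    · have h2 : ∀ t : ℝ, ENNReal.ofReal (Real.exp (-r * t)) *
          ∫⁻ s in Set.Icc 0 t, ENNReal.ofReal (Real.exp (Q x x * s)) *
            ∑' z, offRate Q x z * transitionIter Q n (t - s) z y =
          ∫⁻ s in Set.Icc 0 t, ENNReal.ofReal (Real.exp (-(-(Q x x) + r) * s)) *
            (ENNReal.ofReal (Real.exp (-r * (t - s))) *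
              ∑' z, offRate Q x z * transitionIter Q n (t - s) z y) := by
        intro t
        rw [← lintegral_const_mul' _ _ ENNReal.ofReal_ne_top]
        refine lintegral_congr fun s => ?_
        rw [← mul_assoc, ← mul_assoc, ← hexp s (t - s), add_sub_cancel]
      simp only [h2]
      rw [lintegral_Ici_convolution (by fun_prop) mG, mul_comm]
      congr 1
      simp only [← ENNReal.tsum_mul_left]
      rw [lintegral_tsum]
      · refine tsum_congr fun z => ?_
        rw [← ih z y, ← lintegral_const_mul]
        · refine lintegral_congr fun t => ?_
          ring
        · exact Measurable.mul (by fun_prop) (measurable_transitionIter Q n z y)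
      · intro z
        exact (Measurable.mul (by fun_prop)
          ((measurable_transitionIter Q n z y).const_mul _)).aemeasurable

/-- The resolvent of the minimal process. -/
lemma laplace_minimalTransition [Countable S] (hd : ∀ x, Q x x ≤ 0) {r : ℝ} (hr : 0 ≤ r)
    (x y : S) :
    ∫⁻ t in Set.Ici (0 : ℝ), ENNReal.ofReal (Real.exp (-r * t)) * minimalTransition Q t x y =
      green (offRate Q) (fun x => exitRate Q x + ENNReal.ofReal r) x y := by
  simp only [minimalTransition, ENNReal.mul_iSup, green]
  rw [lintegral_iSup]
  · simp only [laplace_transitionIter hd hr]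
  · exact fun n => Measurable.mul (by fun_prop) (measurable_transitionIter Q n x y)
  · intro m n hmn t
    exact mul_le_mul_right (transitionIter_mono Q t x y hmn) _

lemma meanSojourn_eq_green [Countable S] (hd : ∀ x, Q x x ≤ 0) (x y : S) :
    meanSojourn Q x y = green (offRate Q) (exitRate Q) x y := by
  have h := laplace_minimalTransition hd le_rfl x y
  simp only [neg_zero, zero_mul, Real.exp_zero, ENNReal.ofReal_one, one_mul, ENNReal.ofReal_zero,
    add_zero] at h
  rw [meanSojourn, setLIntegral_congr Ioi_ae_eq_Ici, h]

lemma exitRate_ne_top (x : S) : exitRate Q x ≠ ⊤ := ENNReal.ofReal_ne_top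

/-! ### Stationary distributions: invariance and recurrence -/

variable {p : S → ℝ}

lemma stationary_resolvent [Countable S] (hd : ∀ x, Q x x ≤ 0)
    (hp : IsStationaryDistribution Q p) {r : ℝ} (hr : 0 < r) (y : S) :
    ∑' x, ENNReal.ofReal (p x) *
      green (offRate Q) (fun x => exitRate Q x + ENNReal.ofReal r) x y =
        ENNReal.ofReal (p y) * (ENNReal.ofReal r)⁻¹ := by
  simp only [← laplace_minimalTransition hd hr.le]
  have m : ∀ x, Measurable fun t : ℝ => ENNReal.ofReal (Real.exp (-r * t)) *
      minimalTransition Q t x y :=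
    fun x => Measurable.mul (by fun_prop) (measurable_minimalTransition Q x y)
  simp only [← lintegral_const_mul _ (m _)]
  rw [← lintegral_tsum fun x => ((m x).const_mul _).aemeasurable, ← lintegral_Ici_exp_neg hr.le,
    ← lintegral_const_mul' _ _ ENNReal.ofReal_ne_top]
  refine setLIntegral_congr_fun measurableSet_Ici fun t ht => ?_
  rw [← hp.2.2 t ht y, ← ENNReal.tsum_mul_right]
  refine tsum_congr fun x => ?_
  ring

/-- The forward equation of the resolvent at `r = 1`, summed against `p`, has the extra term `p y`
on both sides; it is finite and cancels. -/
lemma stationary_invariant [Countable S] (hd : ∀ x, Q x x ≤ 0)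
    (hp : IsStationaryDistribution Q p) (y : S) :
    ∑' x, ENNReal.ofReal (p x) * offRate Q x y = ENNReal.ofReal (p y) * exitRate Q y := by
  have h := tsum_mul_green_forward (a := offRate Q)
    (q := fun x => exitRate Q x + ENNReal.ofReal 1) (by simp)
    (fun x => by simp [exitRate_ne_top]) (fun x => ENNReal.ofReal (p x)) y
  simp only [stationary_resolvent hd hp one_pos] at h
  simp only [ENNReal.ofReal_one, inv_one, mul_one, mul_add] at h
  rw [add_comm] at h
  exact ((ENNReal.add_right_inj ENNReal.ofReal_ne_top).1 h).symm

/-- As `r` decreases to `0` the resolvent identity has value `p y / r`, which is unbounded, while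
its left side stays below the diagonal Green function because `p` has mass one. -/
lemma stationary_recurrent [Countable S] (hd : ∀ x, Q x x ≤ 0)
    (h0 : ∀ x, exitRate Q x ≠ 0) (hq : ∀ x, ∑' z, offRate Q x z ≤ exitRate Q x)
    (hp : IsStationaryDistribution Q p) (y : S) (hy : ENNReal.ofReal (p y) ≠ 0) :
    green (offRate Q) (exitRate Q) y y = ⊤ := by
  have h1 : ∀ n : ℕ, ENNReal.ofReal (p y) * (n + 1 : ℕ) ≤ green (offRate Q) (exitRate Q) y y := by
    intro n
    have hr : (0 : ℝ) < ((n + 1 : ℕ) : ℝ)⁻¹ := by positivity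
    have h := stationary_resolvent hd hp hr y
    rw [ENNReal.ofReal_inv_of_pos (by positivity), inv_inv, ENNReal.ofReal_natCast] at h
    rw [← h]
    calc _ ≤ ∑' x, ENNReal.ofReal (p x) * green (offRate Q) (exitRate Q) y y := by
          gcongr with x
          exact (green_antitone_rate _ _ (fun x => le_self_add) x y).trans
            (green_le_diag h0 exitRate_ne_top hq x y)
      _ = 1 * green (offRate Q) (exitRate Q) y y := by
          rw [ENNReal.tsum_mul_right, ← ENNReal.ofReal_tsum_of_nonneg hp.1 hp.2.1.summable,
            hp.2.1.tsum_eq, ENNReal.ofReal_one]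
      _ = _ := one_mul _
  by_contra hne
  obtain ⟨n, hn⟩ := ENNReal.exists_nat_mul_gt hy hne
  have h2 := h1 n
  rw [mul_comm] at h2
  refine absurd (hn.trans_le (le_trans ?_ h2)) (lt_irrefl _)
  gcongr
  exact_mod_cast n.le_succ

/-- A finite Green function yields a matrix inverse. -/
lemma isMatrixInverse_qInverse [Countable S] (hd : ∀ x, Q x x ≤ 0)
    (hoff : ∀ x y, x ≠ y → 0 ≤ Q x y) (h0 : ∀ x, exitRate Q x ≠ 0)
    (hfin : ∀ x y, meanSojourn Q x y ≠ ⊤) : IsMatrixInverse Q (qInverse Q) := by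
  -- Here `u` stands for a row or a column of `Q` with diagonal place `x`. The hypothesis is the
  -- backward or forward equation; finiteness allows the diagonal term to be moved across in `ℝ`.
  have key : ∀ (x y : S) (u : S → ℝ) (T : S → ℝ≥0∞), (∀ z, T z ≠ ⊤) → u x ≤ 0 →
      (∀ z, z ≠ x → 0 ≤ u z) →
      (ENNReal.ofReal (-(u x)) * T x = (if x = y then 1 else 0) +
        ∑' z, (if z = x then 0 else ENNReal.ofReal (u z)) * T z) →
      HasSum (fun z => u z * -(T z).toReal) (if x = y then 1 else 0) := by
    intro x y u T hT hux hu h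
    have hne : ∑' z, (if z = x then 0 else ENNReal.ofReal (u z)) * T z ≠ ⊤ := by
      refine ne_top_of_le_ne_top (ENNReal.mul_ne_top (ENNReal.ofReal_ne_top (r := -(u x))) (hT x)) ?_
      rw [h]
      exact le_add_self
    have hs := ENNReal.hasSum_toReal hne
    rw [← ENNReal.tsum_toReal_eq (fun z => ENNReal.ne_top_of_tsum_ne_top hne z)] at hs
    have h' := congrArg ENNReal.toReal h
    rw [ENNReal.toReal_add (by split_ifs <;> simp) hne, ENNReal.toReal_mul,
      ENNReal.toReal_ofReal (by linarith)] at h'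
    have hd' := hasSum_ite_eq x (-(u x) * (T x).toReal)
    have hsum := hd'.sub hs
    have e : (if x = y then 1 else 0 : ℝ≥0∞).toReal = if x = y then 1 else 0 := by
      split_ifs <;> simp
    rw [e] at h'
    rw [h', add_sub_cancel_right] at hsum
    refine hsum.congr_fun fun z => ?_
    by_cases hz : z = x
    · subst hz
      rw [if_pos rfl, if_pos rfl, ← h']
      simp
    · simp [hz, ENNReal.toReal_ofReal (hu z hz)]
  simp only [meanSojourn_eq_green hd] at hfin
  constructor
  · intro i j
    simp only [qInverse, meanSojourn_eq_green hd]
    exact key i j (fun z => Q i z) (fun z => green (offRate Q) (exitRate Q) z j)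
      (fun z => hfin z j) (hd i) (fun z hz => hoff i z hz.symm)
      (green_backward h0 exitRate_ne_top i j)
  · intro i j
    have h := green_forward (a := offRate Q) h0 exitRate_ne_top i j
    simp only [qInverse, meanSojourn_eq_green hd]
    have := key j i (fun z => Q z j) (fun z => green (offRate Q) (exitRate Q) i z)
      (fun z => hfin i z) (hd j) (fun z hz => hoff z j hz) (by
        rw [mul_comm, ← exitRate, h]
        congr 1
        · simp only [eq_comm]
        · refine tsum_congr fun z => ?_
          simp only [offRate, eq_comm (a := j), mul_comm])
    simpa only [eq_comm (a := j), mul_comm, neg_mul, mul_neg] using this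

/-- For finite matrices multiplication is associative, so a left inverse equals a right inverse. -/
lemma IsMatrixInverse.eq_of_finite [Finite S] {A N N' : S → S → ℝ} (h : IsMatrixInverse A N)
    (h' : IsMatrixInverse A N') : N = N' := by
  have := Fintype.ofFinite S
  have e1 : (Matrix.of N) * (Matrix.of A) = 1 := by
    ext i j
    rw [Matrix.mul_apply, Matrix.one_apply]
    exact (hasSum_fintype _).unique (h.2 i j)
  have e2 : (Matrix.of A) * (Matrix.of N') = 1 := by
    ext i j
    rw [Matrix.mul_apply, Matrix.one_apply]
    exact (hasSum_fintype _).unique (h'.1 i j)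
  exact Matrix.of.injective (left_inv_eq_right_inv e1 e2)

lemma ReflTransGen_offRate (hirr : IsIrreducibleQMatrix Q) (x y : S) :
    Relation.ReflTransGen (fun b c => offRate Q b c ≠ 0 ∧ offRate Q b c ≠ ⊤) x y := by
  refine Relation.ReflTransGen.mono (fun b c h => ?_) x y (hirr x y)
  rw [offRate, if_neg h.1.symm]
  exact ⟨by simpa using h.2, ENNReal.ofReal_ne_top⟩

end Laplace

/-! ### The blocks of a quasi-skip-free process with exit states -/

section Rows

open Classical

variable {S : Type} {Q : S → S → ℝ} {x : S} {k : ℝ}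

/-- The defect `k` of the row sum is a killing rate: zero for the generator, `downRate` for `Q̌` in
phase `0`. -/
lemma hasSum_offDiag (h : HasSum (fun y => Q x y) (-k)) :
    HasSum (fun z => if z = x then 0 else Q x z) (-k - Q x x) := by
  refine (h.sub (hasSum_ite_eq x (Q x x))).congr_fun fun z => ?_
  split_ifs with hz
  · subst hz; simp
  · simp

lemma diag_le_of_hasSum (hoff : ∀ y, x ≠ y → 0 ≤ Q x y) (h : HasSum (fun y => Q x y) (-k)) :
    Q x x ≤ -k := by
  have := (hasSum_offDiag h).nonneg fun z => by
    split_ifs with hz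
    · exact le_rfl
    · exact hoff z (Ne.symm hz)
  linarith

lemma tsum_offRate_add (hoff : ∀ y, x ≠ y → 0 ≤ Q x y) (hk : 0 ≤ k)
    (h : HasSum (fun y => Q x y) (-k)) :
    ∑' z, offRate Q x z + ENNReal.ofReal k = exitRate Q x := by
  have hs := hasSum_offDiag h
  have h0 : ∀ z, 0 ≤ (if z = x then 0 else Q x z) := fun z => by
    split_ifs with hz
    · exact le_rfl
    · exact hoff z (Ne.symm hz)
  have e : ∀ z, offRate Q x z = ENNReal.ofReal (if z = x then 0 else Q x z) := fun z => by
    unfold offRate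
    split_ifs <;> simp
  simp only [e]
  rw [← ENNReal.ofReal_tsum_of_nonneg h0 hs.summable, hs.tsum_eq,
    ← ENNReal.ofReal_add (hs.nonneg h0) hk, exitRate]
  congr 1
  ring

end Rows

namespace QSFBlocks

open Classical

variable {ℓ : ℕ∞} (B : QSFBlocks ℓ)

/-- A conservative irreducible level-homogeneous generator with exit states in phase `0`. -/
structure IsExitGenerator : Prop where
  cons : IsConservativeQMatrix B.generator
  hom : B.HomogeneousConservative
  irr : IsIrreducibleQMatrix B.generator
  exit : ∀ (m : ℤ) (hm : m ≤ 0),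
    IsExitState B.generator (superLevel ℓ m) (⟨m, hm⟩, Phase.zero ℓ)

/-- The total rate of upward jumps by at least `n` levels. -/
noncomputable def upRate (n : ℕ) (i : Phase ℓ) : ℝ := ∑' s : ℕ, ∑' r, B.U (n + s) i r

/-- The total rate of downward jumps. -/
noncomputable def downRate : ℝ := ∑' v, B.D (Phase.zero ℓ) v

lemma generator_down {x y : QSFState ℓ} (h : y.1.1 = x.1.1 - 1) :
    B.generator x y = B.D x.2 y.2 := by
  rw [generator, if_neg (by omega), if_pos h]

lemma generator_far {x y : QSFState ℓ} (h : y.1.1 < x.1.1 - 1) : B.generator x y = 0 := by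
  rw [generator, if_pos h]

lemma generator_same {x y : QSFState ℓ} (h : y.1.1 = x.1.1) (h0 : x.1.1 < 0) :
    B.generator x y = B.W x.2 y.2 := by
  rw [generator, if_neg (by omega), if_neg (by omega), if_neg (by omega), if_pos h]

lemma generator_up {x y : QSFState ℓ} (h : x.1.1 < y.1.1) (h0 : y.1.1 < 0) :
    B.generator x y = B.U (y.1.1 - x.1.1).toNat x.2 y.2 := by
  rw [generator, if_neg (by omega), if_neg (by omega), if_neg (by omega), if_neg (by omega)]

lemma Qcheck_eq (i j : Phase ℓ) : B.Qcheck i j = B.W i j + B.upRate 1 i * B.entrance j := by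
  simp only [Qcheck, upRate, tsum_mul_right]

lemma Acheck_eq (m : ℤ) (x : subLevel ℓ (m - 1)) (j : Phase ℓ) : B.Acheck m x j =
    B.U (m - x.1.1.1).toNat x.1.2 j +
      B.upRate (m + 1 - x.1.1.1).toNat x.1.2 * B.entrance j := by
  simp only [Acheck, upRate, tsum_mul_right]

variable {B}

/-! ### Block rates and flows between levels -/

namespace IsExitGenerator

lemma summable_row (hB : B.IsExitGenerator) (x : QSFState ℓ) (l : {m : ℤ // m ≤ 0}) :
    Summable fun r => B.generator x (l, r) :=
  (hB.cons.2 x).summable.comp_injective (Prod.mk_right_injective l)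

lemma summable_D (hB : B.IsExitGenerator) (i : Phase ℓ) : Summable (B.D i) :=
  (hB.summable_row (⟨-1, by omega⟩, i) ⟨-2, by omega⟩).congr fun _ =>
    B.generator_down (by norm_num)

lemma summable_W (hB : B.IsExitGenerator) (i : Phase ℓ) : Summable (B.W i) :=
  -- Level `-1` is the highest one whose diagonal block is `W` and not the boundary block `W'`.
  (hB.summable_row (⟨-1, by omega⟩, i) ⟨-1, by omega⟩).congr fun _ =>
    B.generator_same rfl (by norm_num)

lemma D_nonneg (hB : B.IsExitGenerator) (i j : Phase ℓ) : 0 ≤ B.D i j := by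
  rw [← B.generator_down (x := (⟨-1, by omega⟩, i)) (y := (⟨-2, by omega⟩, j)) (by norm_num)]
  exact hB.cons.1 _ _ (by simp)

lemma W_nonneg (hB : B.IsExitGenerator) {i j : Phase ℓ} (hij : i ≠ j) : 0 ≤ B.W i j := by
  rw [← B.generator_same (x := (⟨-1, by omega⟩, i)) (y := (⟨-1, by omega⟩, j)) rfl (by norm_num)]
  exact hB.cons.1 _ _ (by simp [hij])

lemma U_nonneg (hB : B.IsExitGenerator) {s : ℕ} (hs : 1 ≤ s) (i j : Phase ℓ) : 0 ≤ B.U s i j := by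
  have h := B.generator_up (x := (⟨-1 - s, by omega⟩, i)) (y := (⟨-1, by omega⟩, j))
    (by dsimp only; omega) (by norm_num)
  have e : ((-1 : ℤ) - (-1 - s)).toNat = s := by omega
  simp only [e] at h
  rw [← h]
  exact hB.cons.1 _ _ (by simp; omega)

/-- Level `0` is a whole super-level set, and it is left only by downward jumps, so its exit
condition annihilates every other row of `D`. -/
lemma D_eq_zero (hB : B.IsExitGenerator) {i : Phase ℓ} (hi : i ≠ Phase.zero ℓ) (j : Phase ℓ) :
    B.D i j = 0 := by
  have h := (hB.exit 0 le_rfl).2.1 (⟨0, le_rfl⟩, i) (by simp [superLevel]) (by simpa using hi)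
  have hs : Summable fun z : ((superLevel ℓ 0)ᶜ : Set (QSFState ℓ)) =>
      B.generator (⟨0, le_rfl⟩, i) z := (hB.cons.2 _).summable.subtype _
  have hn : ∀ z : ((superLevel ℓ 0)ᶜ : Set (QSFState ℓ)), 0 ≤ B.generator (⟨0, le_rfl⟩, i) z := by
    intro z
    refine hB.cons.1 _ _ fun hz => z.2 ?_
    rw [← hz]
    simp [superLevel]
  have h0 := (hasSum_zero_iff_of_nonneg hn).1 (h ▸ hs.hasSum)
  have h1 := congrFun h0 ⟨(⟨-1, by omega⟩, j), by simp [superLevel]⟩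
  rwa [B.generator_down (by norm_num)] at h1

lemma downRate_pos (hB : B.IsExitGenerator) : 0 < B.downRate := by
  have h := (hB.exit 0 le_rfl).2.2
  by_contra hc
  have hz : ∑' v, B.D (Phase.zero ℓ) v = 0 := le_antisymm (not_lt.1 hc) (tsum_nonneg (hB.D_nonneg _))
  have h0 := (hasSum_zero_iff_of_nonneg (hB.D_nonneg (Phase.zero ℓ))).1
    (hz ▸ (hB.summable_D (Phase.zero ℓ)).hasSum)
  refine h.ne' ((tsum_congr (g := fun _ => 0) ?_).trans tsum_zero)
  rintro ⟨⟨⟨l, hl⟩, r⟩, hz⟩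
  simp only [superLevel, Set.mem_compl_iff, Set.mem_ofPred_eq, not_le] at hz
  rcases lt_or_eq_of_le (show l ≤ -1 by omega) with h1 | rfl
  · exact B.generator_far (by dsimp only; omega)
  · rw [B.generator_down (by norm_num)]
    exact congrFun h0 r

lemma tsum_D (hB : B.IsExitGenerator) (i : Phase ℓ) :
    ∑' r, B.D i r = if i = Phase.zero ℓ then B.downRate else 0 := by
  split_ifs with h
  · rw [h]; rfl
  · simp [hB.D_eq_zero h]

lemma summable_tsum_U (hB : B.IsExitGenerator) (n : ℕ) (i : Phase ℓ) :
    Summable fun s : ℕ => ∑' r, B.U (n + 1 + s) i r := by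
  refine ((summable_nat_add_iff n).2 (hB.hom i).summable).congr fun s => ?_
  rw [show s + n + 1 = n + 1 + s by ring]

lemma upRate_one (hB : B.IsExitGenerator) (i : Phase ℓ) :
    B.upRate 1 i = -((∑' r, B.D i r) + ∑' r, B.W i r) := by
  rw [← (hB.hom i).tsum_eq, upRate]
  simp only [add_comm 1]

lemma upRate_succ (hB : B.IsExitGenerator) (n : ℕ) (i : Phase ℓ) :
    B.upRate (n + 1) i = ∑' r, B.U (n + 1) i r + B.upRate (n + 2) i := by
  rw [upRate, (hB.summable_tsum_U n i).tsum_eq_zero_add, add_zero, upRate]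
  congr 1
  refine tsum_congr fun s => ?_
  rw [show n + 1 + (s + 1) = n + 2 + s by ring]

lemma upRate_nonneg (hB : B.IsExitGenerator) {n : ℕ} (hn : 1 ≤ n) (i : Phase ℓ) :
    0 ≤ B.upRate n i :=
  tsum_nonneg fun s => tsum_nonneg fun r => hB.U_nonneg (by omega) i r

lemma entrance_nonneg (hB : B.IsExitGenerator) (j : Phase ℓ) : 0 ≤ B.entrance j :=
  div_nonneg (hB.D_nonneg _ _) hB.downRate_pos.le

lemma downRate_mul_entrance (hB : B.IsExitGenerator) (j : Phase ℓ) :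
    B.downRate * B.entrance j = B.D (Phase.zero ℓ) j :=
  mul_div_cancel₀ _ hB.downRate_pos.ne'

lemma hasSum_entrance (hB : B.IsExitGenerator) : HasSum B.entrance 1 := by
  have h := (hB.summable_D (Phase.zero ℓ)).hasSum.div_const B.downRate
  rwa [show ∑' r, B.D (Phase.zero ℓ) r = B.downRate from rfl,
    div_self hB.downRate_pos.ne'] at h

/-- The boundary blocks `U'` are never inspected: the zero row sums of the generator and of the
homogeneous part force the same total upward rate. The induction then removes one interior level at
a time. -/
lemma hasSum_levels_above (hB : B.IsExitGenerator) (k : {m : ℤ // m ≤ 0}) (i : Phase ℓ) (n : ℕ)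
    (hn : k.1 + n < 0) :
    HasSum (fun l : {m : ℤ // m ≤ 0} => if k.1 + n < l.1 then ∑' r, B.generator (k, i) (l, r) else 0)
      (B.upRate (n + 1) i) := by
  induction n with
  | zero =>
    have h := (hB.cons.2 (k, i)).prod_fiberwise fun l => (hB.summable_row (k, i) l).hasSum
    have h1 := hasSum_ite_eq (⟨k.1 - 1, by have := k.2; omega⟩ : {m : ℤ // m ≤ 0}) (∑' r, B.D i r)
    have h2 := hasSum_ite_eq k (∑' r, B.W i r)
    have h3 := (h.sub h1).sub h2
    rw [zero_add, hB.upRate_one i]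
    have e : -((∑' r, B.D i r) + ∑' r, B.W i r) = 0 - ∑' r, B.D i r - ∑' r, B.W i r := by ring
    rw [e]
    refine h3.congr_fun fun l => ?_
    simp only [Subtype.ext_iff]
    push_cast
    rcases lt_trichotomy l.1 (k.1 - 1) with hl | hl | hl
    · rw [if_neg (by omega), if_neg (by omega), if_neg (by omega)]
      simp [B.generator_far (x := (k, i)) (y := (l, _)) hl]
    · rw [if_neg (by omega), if_pos hl, if_neg (by omega)]
      simp [B.generator_down (x := (k, i)) (y := (l, _)) hl]
    · rw [if_neg hl.ne']
      rcases eq_or_lt_of_le (show k.1 ≤ l.1 by omega) with hl' | hl'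
      · rw [if_neg (by omega), if_pos hl'.symm]
        have : ∀ r, B.generator (k, i) (l, r) = B.W i r := fun r =>
          B.generator_same (x := (k, i)) (y := (l, r)) hl'.symm (by simpa using hn)
        simp [this]
      · rw [if_pos (by omega), if_neg (by omega)]
        simp
  | succ n ih =>
    have ih := ih (by push_cast at hn; omega)
    have h1 := hasSum_ite_eq (⟨k.1 + (n + 1 : ℕ), hn.le⟩ : {m : ℤ // m ≤ 0})
      (∑' r, B.U (n + 1) i r)
    have h3 := ih.sub h1
    rw [hB.upRate_succ, add_sub_cancel_left] at h3
    refine h3.congr_fun fun l => ?_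
    simp only [Subtype.ext_iff]
    by_cases hl : l.1 = k.1 + (n + 1 : ℕ)
    · rw [if_pos hl, if_neg (by omega), if_pos (by push_cast at hl; omega)]
      have : ∀ r, B.generator (k, i) (l, r) = B.U (n + 1) i r := fun r => by
        rw [B.generator_up (x := (k, i)) (y := (l, r)) (by dsimp only; omega) (by dsimp only; omega)]
        congr 1
        dsimp only
        omega
      simp [this]
    · rw [if_neg hl, sub_zero]
      congr 1
      simp only [eq_iff_iff]
      push_cast at hl ⊢
      omega

lemma tsum_above (hB : B.IsExitGenerator) {m : ℤ} (hm : m < 0) (x : QSFState ℓ) (hx : x.1.1 ≤ m) :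
    ∑' z : QSFState ℓ, (if m < z.1.1 then offRate B.generator x z else 0) =
      ENNReal.ofReal (B.upRate (m + 1 - x.1.1).toNat x.2) := by
  obtain ⟨n, rfl⟩ : ∃ n : ℕ, m = x.1.1 + n := ⟨(m - x.1.1).toNat, by omega⟩
  have h := hB.hasSum_levels_above x.1 x.2 n hm
  rw [show (x.1.1 + n + 1 - x.1.1).toNat = n + 1 by omega, ← h.tsum_eq,
    ENNReal.ofReal_tsum_of_nonneg _ h.summable, ENNReal.tsum_prod']
  · refine tsum_congr fun l => ?_
    split_ifs with hl
    · have e : ∀ r, offRate B.generator x (l, r) = ENNReal.ofReal (B.generator (x.1, x.2) (l, r)) := by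
        intro r
        rw [offRate, if_neg]
        intro hz
        rw [← hz] at hl
        dsimp only at hl
        omega
      simp only [e]
      rw [ENNReal.ofReal_tsum_of_nonneg _ (hB.summable_row _ l)]
      intro r
      refine hB.cons.1 _ _ fun hz => ?_
      have := congrArg (fun w => w.1.1) hz
      dsimp only at this
      omega
    · simp
  · intro l
    split_ifs with hl
    · refine tsum_nonneg fun r => hB.cons.1 _ _ fun hz => ?_
      have := congrArg (fun w => w.1.1) hz
      dsimp only at this
      omega
    · exact le_rfl

lemma generator_diag_nonpos (hB : B.IsExitGenerator) (x : QSFState ℓ) : B.generator x x ≤ 0 := by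
  simpa using diag_le_of_hasSum (k := 0) (hB.cons.1 x) (by simpa using hB.cons.2 x)

lemma tsum_offRate_generator (hB : B.IsExitGenerator) (x : QSFState ℓ) :
    ∑' z, offRate B.generator x z = exitRate B.generator x := by
  simpa using tsum_offRate_add (k := 0) (hB.cons.1 x) le_rfl (by simpa using hB.cons.2 x)

lemma exitRate_generator_ne_zero (hB : B.IsExitGenerator) (x : QSFState ℓ) :
    exitRate B.generator x ≠ 0 := by
  rw [← hB.tsum_offRate_generator]
  intro h
  have hne : x ≠ (⟨x.1.1 - 1, by have := x.1.2; omega⟩, x.2) := by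
    intro h
    have := congrArg (fun w => w.1.1) h
    dsimp only at this
    omega
  rcases (Relation.ReflTransGen.cases_head (ReflTransGen_offRate hB.irr x _)) with h1 | ⟨c, h1, _⟩
  · exact hne h1
  · exact h1.1 (ENNReal.tsum_eq_zero.1 h c)

/-- From above level `m`, the levels `≤ m` are entered through one state only. -/
lemma tsum_above_add (hB : B.IsExitGenerator) {m : ℤ} (hm : m < 0) (x : QSFState ℓ)
    (hx : m < x.1.1) :
    ∑' z : QSFState ℓ, (if m < z.1.1 then offRate B.generator x z else 0) +
      (if x = (⟨m + 1, by omega⟩, Phase.zero ℓ) then ENNReal.ofReal B.downRate else 0) =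
      exitRate B.generator x := by
  rw [← hB.tsum_offRate_generator x]
  have e : ∀ z : QSFState ℓ, offRate B.generator x z =
      (if m < z.1.1 then offRate B.generator x z else 0) +
      (if m < z.1.1 then 0 else offRate B.generator x z) := fun z => by split_ifs <;> simp
  rw [tsum_congr e, ENNReal.tsum_add]
  congr 1
  -- From above level `m`, skip-freeness leaves `m` as the only target level among those up to `m`.
  rw [ENNReal.tsum_prod', tsum_eq_single (⟨m, hm.le⟩ : {m : ℤ // m ≤ 0})]
  · have e : ∀ r, (if m < m then 0 else offRate B.generator x ((⟨m, hm.le⟩ : {m : ℤ // m ≤ 0}), r)) =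
        ENNReal.ofReal (if x.1.1 = m + 1 then B.D x.2 r else 0) := by
      intro r
      rw [if_neg (lt_irrefl m), offRate, if_neg (by rintro rfl; exact lt_irrefl _ hx)]
      split_ifs with h
      · rw [B.generator_down (by dsimp only; omega)]
      · rw [B.generator_far (by dsimp only; omega)]
    simp only [e]
    by_cases h : x.1.1 = m + 1
    · simp only [h, if_true]
      rw [← ENNReal.ofReal_tsum_of_nonneg (hB.D_nonneg _) (hB.summable_D _), hB.tsum_D]
      have : x = (⟨m + 1, by omega⟩, Phase.zero ℓ) ↔ x.2 = Phase.zero ℓ := by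
        rw [Prod.ext_iff, Subtype.ext_iff]
        simp [h]
      simp only [this]
      split_ifs <;> simp
    · rw [if_neg]
      · simp [h]
      · intro hx'
        exact h (by rw [hx'])
  · intro l hl
    rw [ENNReal.tsum_eq_zero]
    intro r
    rw [ne_eq, Subtype.ext_iff] at hl
    split_ifs with h
    · rfl
    · dsimp only at h hl
      rw [offRate, B.generator_far (by dsimp only; omega)]
      simp

/-- Decomposition of the flow into the state `(m, j)` by the level of the origin. -/
lemma tsum_flow_into (hB : B.IsExitGenerator) {m : ℤ} (hm : m < 0) (j : Phase ℓ)
    (p : QSFState ℓ → ℝ≥0∞) :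
    ∑' x, p x * offRate B.generator x (⟨m, hm.le⟩, j) =
      ∑' x : subLevel ℓ (m - 1), p x.1 * ENNReal.ofReal (B.U (m - x.1.1.1).toNat x.1.2 j) +
      ∑' i, p (⟨m, hm.le⟩, i) * offRate B.W i j +
      p (⟨m + 1, by omega⟩, Phase.zero ℓ) * ENNReal.ofReal (B.D (Phase.zero ℓ) j) := by
  have e : ∀ x, p x * offRate B.generator x (⟨m, hm.le⟩, j) =
      (subLevel ℓ (m - 1)).indicator (fun x => p x * ENNReal.ofReal (B.U (m - x.1.1).toNat x.2 j)) x +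
      (if x.1 = ⟨m, hm.le⟩ then p x * offRate B.W x.2 j else 0) +
      (if x = (⟨m + 1, by omega⟩, Phase.zero ℓ) then
        p x * ENNReal.ofReal (B.D (Phase.zero ℓ) j) else 0) := by
    rintro ⟨⟨k, hk⟩, i⟩
    simp only [Set.indicator_apply, subLevel, Set.mem_ofPred_eq, Subtype.mk.injEq, Prod.mk.injEq]
    rcases lt_trichotomy k m with h | h | h
    · rw [if_pos (by omega), if_neg h.ne, if_neg (by omega), add_zero, add_zero, offRate,
        if_neg (by simp; omega), B.generator_up (by simpa using h) hm]
    · subst h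
      rw [if_neg (by omega), if_pos rfl, if_neg (by omega), zero_add, add_zero, offRate, offRate,
        B.generator_same (x := (⟨k, hk⟩, i)) (y := (⟨k, hk⟩, j)) rfl hm]
      simp
    · rw [if_neg (by omega), if_neg h.ne', zero_add, zero_add, offRate, if_neg (by simp; omega)]
      by_cases h1 : k = m + 1
      · rw [B.generator_down (by dsimp only; omega)]
        by_cases h2 : i = Phase.zero ℓ
        · simp [h1, h2]
        · simp [h1, h2, hB.D_eq_zero h2]
      · rw [B.generator_far (by dsimp only; omega)]
        simp [h1]
  rw [tsum_congr e, ENNReal.tsum_add, ENNReal.tsum_add, tsum_ite_eq,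
    tsum_subtype (subLevel ℓ (m - 1))
      (fun x => p x * ENNReal.ofReal (B.U (m - x.1.1).toNat x.2 j)), ENNReal.tsum_prod',
    ENNReal.tsum_prod' (f := fun x : QSFState ℓ => if x.1 = ⟨m, hm.le⟩ then _ else _),
    tsum_eq_single (f := fun l : {m : ℤ // m ≤ 0} => ∑' r : Phase ℓ, if l = ⟨m, hm.le⟩ then _ else _)
      (⟨m, hm.le⟩ : {m : ℤ // m ≤ 0}), ← ENNReal.tsum_prod']
  · simp
  · intro l hl
    simp [hl]

/-! ### The censored generator `Q̌` and its Green function -/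

lemma hasSum_Qcheck (hB : B.IsExitGenerator) (i : Phase ℓ) :
    HasSum (fun j => B.Qcheck i j) (-(if i = Phase.zero ℓ then B.downRate else 0)) := by
  have h := (hB.summable_W i).hasSum.add (hB.hasSum_entrance.mul_left (B.upRate 1 i))
  simp only [Qcheck_eq]
  rw [hB.upRate_one, hB.tsum_D] at h
  rw [hB.upRate_one, hB.tsum_D]
  convert h using 1
  ring

lemma Qcheck_nonneg (hB : B.IsExitGenerator) {i j : Phase ℓ} (hij : i ≠ j) :
    0 ≤ B.Qcheck i j := by
  rw [Qcheck_eq]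
  exact add_nonneg (hB.W_nonneg hij) (mul_nonneg (hB.upRate_nonneg le_rfl i) (hB.entrance_nonneg j))

lemma Qcheck_diag_nonpos (hB : B.IsExitGenerator) (i : Phase ℓ) : B.Qcheck i i ≤ 0 := by
  refine (diag_le_of_hasSum (fun y => hB.Qcheck_nonneg) (hB.hasSum_Qcheck i)).trans ?_
  split_ifs
  · simpa using hB.downRate_pos.le
  · simp

lemma tsum_offRate_Qcheck (hB : B.IsExitGenerator) (i : Phase ℓ) :
    ∑' z, offRate B.Qcheck i z + (if i = Phase.zero ℓ then ENNReal.ofReal B.downRate else 0) =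
      exitRate B.Qcheck i := by
  rw [← tsum_offRate_add (fun y => hB.Qcheck_nonneg) _ (hB.hasSum_Qcheck i)]
  · split_ifs <;> simp
  · split_ifs
    · exact hB.downRate_pos.le
    · exact le_rfl

/-- An excursion returning to its phase of departure is no jump of `Q̌`. The conditional term
accounts for it here, and `exitRate_Qcheck` makes the matching diagonal correction. -/
lemma offRate_Qcheck (hB : B.IsExitGenerator) (i j : Phase ℓ) :
    offRate B.Qcheck i j + (if j = i then ENNReal.ofReal (B.upRate 1 i) * ENNReal.ofReal (B.entrance j)
      else 0) =
    offRate B.W i j + ENNReal.ofReal (B.upRate 1 i) * ENNReal.ofReal (B.entrance j) := by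
  unfold offRate
  split_ifs with h
  · rfl
  · rw [add_zero, Qcheck_eq, ENNReal.ofReal_add (hB.W_nonneg (Ne.symm h))
      (mul_nonneg (hB.upRate_nonneg le_rfl i) (hB.entrance_nonneg j)),
      ENNReal.ofReal_mul (hB.upRate_nonneg le_rfl i)]

lemma exitRate_Qcheck (hB : B.IsExitGenerator) (j : Phase ℓ) :
    exitRate B.Qcheck j + ENNReal.ofReal (B.upRate 1 j) * ENNReal.ofReal (B.entrance j) =
      exitRate B.W j := by
  have h := hB.Qcheck_diag_nonpos j
  unfold exitRate
  rw [← ENNReal.ofReal_mul (hB.upRate_nonneg le_rfl j), ← ENNReal.ofReal_add (by linarith)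
      (mul_nonneg (hB.upRate_nonneg le_rfl j) (hB.entrance_nonneg j)), Qcheck_eq]
  congr 1
  ring

/-- In the censored process the phase `0` can be reached from every phase. -/
lemma path_Qcheck (hB : B.IsExitGenerator) (i : Phase ℓ) :
    Relation.ReflTransGen (fun b c => offRate B.Qcheck b c ≠ 0) i (Phase.zero ℓ) := by
  set C : Set (Phase ℓ) :=
    {i | Relation.ReflTransGen (fun b c => offRate B.Qcheck b c ≠ 0) i (Phase.zero ℓ)}
  have hC0 : Phase.zero ℓ ∈ C := Relation.ReflTransGen.refl
  have hCs : ∀ i j, i ∉ C → j ∈ C → offRate B.Qcheck i j = 0 := fun i j hi hj => by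
    by_contra h
    exact hi (Relation.ReflTransGen.head h hj)
  change i ∈ C
  by_contra hi
  -- By irreducibility, a set separating these two states is left by some jump of positive rate. In
  -- both cases below, a set closed under jumps contradicts this.
  have absurdum : ∀ N : Set (QSFState ℓ), (⟨-1, by omega⟩, i) ∈ N →
      (⟨-2, by omega⟩, Phase.zero ℓ) ∉ N →
      ∃ b ∈ N, ∃ c, c ∉ N ∧ b ≠ c ∧ 0 < B.generator b c := by
    intro N h1 h2
    by_contra! hN
    refine h2 ?_
    have hpath := hB.irr (⟨-1, by omega⟩, i) (⟨-2, by omega⟩, Phase.zero ℓ)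
    generalize ((⟨-2, by omega⟩, Phase.zero ℓ) : QSFState ℓ) = y at hpath ⊢
    induction hpath with
    | refl => exact h1
    | @tail b c _ hbc ih =>
      by_contra hc
      exact absurd hbc.2 (not_lt.2 (hN b ih c hc hbc.1))
  have hW : ∀ i j, i ∉ C → j ∈ C → ¬ 0 < B.W i j := by
    intro i j hi hj hw
    have hij : j ≠ i := fun h => hi (h ▸ hj)
    have h1 := hB.offRate_Qcheck i j
    rw [if_neg hij, hCs i j hi hj, add_zero, offRate, if_neg hij] at h1
    have := (add_eq_zero.1 h1.symm).1
    rw [ENNReal.ofReal_eq_zero] at this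
    linarith
  have hU : ∀ i j, i ∉ C → j ∈ C → 0 < B.entrance j → B.upRate 1 i ≤ 0 := by
    intro i j hi hj he
    have hij : j ≠ i := fun h => hi (h ▸ hj)
    have h1 := hB.offRate_Qcheck i j
    rw [if_neg hij, hCs i j hi hj, add_zero] at h1
    have := (add_eq_zero.1 h1.symm).2
    rcases mul_eq_zero.1 this with h | h
    · exact ENNReal.ofReal_eq_zero.1 h
    · exact absurd (ENNReal.ofReal_eq_zero.1 h) (not_le.2 he)
  by_cases hA : ∃ j ∈ C, 0 < B.entrance j
  · obtain ⟨j, hj, he⟩ := hA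
    obtain ⟨⟨⟨b, hb0⟩, b'⟩, ⟨hb1, hb2⟩, ⟨⟨c, hc0⟩, c'⟩, hc, hne, hpos⟩ := absurdum
      {x | x.1.1 = -1 ∧ x.2 ∉ C} ⟨rfl, hi⟩ (by simp)
    dsimp only at hb1 hb2
    subst hb1
    simp only [Set.mem_ofPred_eq, not_and, not_not] at hc
    rcases lt_trichotomy c (-1) with h | rfl | h
    · rcases eq_or_lt_of_le (show c ≤ -1 - 1 by omega) with h2 | h2
      · rw [B.generator_down (by simpa using h2), hB.D_eq_zero (i := b') fun h => hb2 (by rw [h]; exact hC0)] at hpos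
        exact lt_irrefl _ hpos
      · rw [B.generator_far (by simpa using h2)] at hpos
        exact lt_irrefl _ hpos
    · rw [B.generator_same (x := (⟨-1, hb0⟩, b')) (y := (⟨-1, hc0⟩, c')) rfl (by norm_num)] at hpos
      exact hW _ _ hb2 (hc rfl) hpos
    · have h1 := hB.tsum_above (m := -1) (by norm_num) (⟨-1, hb0⟩, b') le_rfl
      rw [show ((-1 : ℤ) + 1 - (-1)).toNat = 1 by norm_num,
        ENNReal.ofReal_eq_zero.2 (hU b' j hb2 hj he), ENNReal.tsum_eq_zero] at h1
      have h2 := h1 (⟨c, hc0⟩, c')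
      rw [if_pos (by simpa using h), offRate, if_neg hne.symm, ENNReal.ofReal_eq_zero] at h2
      linarith
  -- Otherwise excursions return only outside `C`, and adding all of level `0` to that set makes it
  -- closed.
  · push Not at hA
    obtain ⟨⟨⟨b, hb0⟩, b'⟩, hb, ⟨⟨c, hc0⟩, c'⟩, hc, hne, hpos⟩ := absurdum
      {x | x.1.1 = 0 ∨ x.1.1 = -1 ∧ x.2 ∉ C} (Or.inr ⟨rfl, hi⟩) (by simp)
    simp only [Set.mem_ofPred_eq, not_or, not_and, not_not] at hb hc
    have hD : ∀ j, j ∈ C → B.D (Phase.zero ℓ) j ≤ 0 := fun j hj => by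
      rw [← hB.downRate_mul_entrance]
      exact mul_nonpos_of_nonneg_of_nonpos hB.downRate_pos.le (hA j hj)
    rcases hb with rfl | ⟨rfl, hb2⟩
    · rcases eq_or_lt_of_le (show c ≤ 0 - 1 by omega) with h2 | h2
      · rw [B.generator_down (by simpa using h2)] at hpos
        by_cases hb' : b' = Phase.zero ℓ
        · subst hb'
          exact absurd hpos (not_lt.2 (hD _ (hc.2 h2)))
        · rw [hB.D_eq_zero hb'] at hpos
          exact lt_irrefl _ hpos
      · rw [B.generator_far (by simpa using h2)] at hpos
        exact lt_irrefl _ hpos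
    · rcases eq_or_lt_of_le (show c ≤ -1 by omega) with rfl | h
      · rw [B.generator_same (x := (⟨-1, hb0⟩, b')) (y := (⟨-1, hc0⟩, c')) rfl (by norm_num)] at hpos
        exact hW _ _ hb2 (hc.2 rfl) hpos
      · rcases eq_or_lt_of_le (show c ≤ -1 - 1 by omega) with h2 | h2
        · rw [B.generator_down (by simpa using h2), hB.D_eq_zero (i := b') fun h => hb2 (by rw [h]; exact hC0)] at hpos
          exact lt_irrefl _ hpos
        · rw [B.generator_far (by simpa using h2)] at hpos
          exact lt_irrefl _ hpos

lemma exitRate_Qcheck_ne_zero (hB : B.IsExitGenerator) (i : Phase ℓ) :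
    exitRate B.Qcheck i ≠ 0 := by
  rw [← hB.tsum_offRate_Qcheck]
  intro h
  obtain ⟨h1, h2⟩ := add_eq_zero.1 h
  rcases (hB.path_Qcheck i).cases_head with rfl | ⟨c, hc, _⟩
  · rw [if_pos rfl, ENNReal.ofReal_eq_zero] at h2
    exact absurd hB.downRate_pos (not_lt.2 h2)
  · exact hc (ENNReal.tsum_eq_zero.1 h1 c)

/-- The constant `1` is superharmonic with defect `downRate` in phase `0`, which bounds the Green
function there; finiteness spreads to every target from which phase `0` can be reached. -/
lemma green_Qcheck_ne_top (hB : B.IsExitGenerator) (i j : Phase ℓ) :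
    green (offRate B.Qcheck) (exitRate B.Qcheck) i j ≠ ⊤ := by
  refine green_ne_top_of_path hB.exitRate_Qcheck_ne_zero exitRate_ne_top i (hB.path_Qcheck j) ?_
  have h := mul_green_le_of_superharmonic (a := offRate B.Qcheck) hB.exitRate_Qcheck_ne_zero
    exitRate_ne_top (v := fun _ => 1) (c := ENNReal.ofReal B.downRate) (y := Phase.zero ℓ)
    (fun x => by
      simp only [mul_one]
      rw [add_comm, ← hB.tsum_offRate_Qcheck x]
      split_ifs <;> exact le_rfl) i
  intro ht
  rw [ht, ENNReal.mul_top] at h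
  · exact absurd h (by simp)
  · simpa using hB.downRate_pos

end IsExitGenerator

end QSFBlocks

/-! ### Excursions above level `m` and the measure on level `m` -/

namespace QSFBlocks

open Classical

variable {ℓ : ℕ∞} {B : QSFBlocks ℓ}

variable (B) in
/-- The rates of jumps to levels above `m`. -/
noncomputable def rateAbove (m : ℤ) (x z : QSFState ℓ) : ℝ≥0∞ :=
  if m < z.1.1 then offRate B.generator x z else 0

variable (B) in
/-- The flow from the levels up to `m` into a state above level `m`, under the measure `p`. -/
noncomputable def inflow (m : ℤ) (p : QSFState ℓ → ℝ≥0∞) (y : QSFState ℓ) : ℝ≥0∞ :=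
  ∑' x, (if x.1.1 ≤ m then p x else 0) * B.rateAbove m x y

variable (B) in
/-- Mean sojourn times before leaving the set of levels above `m`. -/
noncomputable abbrev greenAbove (m : ℤ) : QSFState ℓ → QSFState ℓ → ℝ≥0∞ :=
  green (B.rateAbove m) (exitRate B.generator)

namespace IsExitGenerator

lemma inflow_eq_zero {m : ℤ} {p : QSFState ℓ → ℝ≥0∞} {y : QSFState ℓ} (hy : y.1.1 ≤ m) :
    B.inflow m p y = 0 := by
  simp [inflow, rateAbove, not_lt.2 hy]

lemma inflow_mono {m : ℤ} {p p' : QSFState ℓ → ℝ≥0∞} (h : ∀ x, x.1.1 ≤ m → p x ≤ p' x)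
    (y : QSFState ℓ) : B.inflow m p y ≤ B.inflow m p' y := by
  refine ENNReal.tsum_le_tsum fun x => mul_le_mul_left ?_ _
  split_ifs with hx
  · exact h x hx
  · exact le_rfl

/-- Level `m` is kept apart from the lower levels because its excursions enter `Q̌`, while theirs
enter `Ǎ`. -/
lemma tsum_inflow (hB : B.IsExitGenerator) {m : ℤ} (hm : m < 0) (p : QSFState ℓ → ℝ≥0∞) :
    ∑' y, B.inflow m p y =
      ∑' x : subLevel ℓ (m - 1),
        p x.1 * ENNReal.ofReal (B.upRate (m + 1 - x.1.1.1).toNat x.1.2) +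
      ∑' i, p (⟨m, hm.le⟩, i) * ENNReal.ofReal (B.upRate 1 i) := by
  have e : ∀ x : QSFState ℓ, ∑' y, (if x.1.1 ≤ m then p x else 0) * B.rateAbove m x y =
      (subLevel ℓ (m - 1)).indicator
        (fun x => p x * ENNReal.ofReal (B.upRate (m + 1 - x.1.1).toNat x.2)) x +
      (if x.1 = ⟨m, hm.le⟩ then p x * ENNReal.ofReal (B.upRate 1 x.2) else 0) := by
    intro x
    rw [ENNReal.tsum_mul_left]
    simp only [Set.indicator_apply, subLevel, Set.mem_ofPred_eq, Subtype.ext_iff]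
    rcases lt_trichotomy x.1.1 m with h | h | h
    · rw [if_pos h.le, if_pos (by omega), if_neg h.ne, add_zero, ← hB.tsum_above hm x h.le]
      rfl
    · rw [if_pos h.le, if_neg (by omega), if_pos h, zero_add,
        show 1 = (m + 1 - x.1.1).toNat by omega, ← hB.tsum_above hm x h.le]
      rfl
    · rw [if_neg (by omega), if_neg (by omega), if_neg (by omega)]
      simp
  simp only [inflow]
  rw [ENNReal.tsum_comm, tsum_congr e, ENNReal.tsum_add, tsum_subtype (subLevel ℓ (m - 1))
      (fun x => p x * ENNReal.ofReal (B.upRate (m + 1 - x.1.1).toNat x.2)),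
    ENNReal.tsum_prod' (f := fun x : QSFState ℓ => if x.1 = ⟨m, hm.le⟩ then _ else _),
    tsum_eq_single (f := fun l : {m : ℤ // m ≤ 0} => ∑' r : Phase ℓ, if l = ⟨m, hm.le⟩ then _ else _)
      (⟨m, hm.le⟩ : {m : ℤ // m ≤ 0})]
  · simp
  · intro l hl
    simp [hl]

/-- The process is recurrent. -/
def IsRecurrent (B : QSFBlocks ℓ) : Prop :=
  ∀ x, green (offRate B.generator) (exitRate B.generator) x x = ⊤

/-- By recurrence, the levels up to `m` are almost surely reached from above. -/
lemma downRate_mul_greenAbove (hB : B.IsExitGenerator) (hrec : IsRecurrent B) {m : ℤ} (hm : m < 0)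
    (x : QSFState ℓ) (hx : m < x.1.1) :
    ENNReal.ofReal B.downRate * B.greenAbove m x (⟨m + 1, by omega⟩, Phase.zero ℓ) = 1 := by
  set a := offRate B.generator
  set q := exitRate B.generator
  set d := ENNReal.ofReal B.downRate
  set y : QSFState ℓ := (⟨m + 1, by omega⟩, Phase.zero ℓ)
  have h0 : ∀ x, q x ≠ 0 := hB.exitRate_generator_ne_zero
  have habove : ∀ x, m < x.1.1 → ∑' z, B.rateAbove m x z + (if x = y then d else 0) = q x :=
    fun x hx => hB.tsum_above_add hm x hx
  have hle : ∀ x, m < x.1.1 → d * B.greenAbove m x y ≤ 1 := by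
    intro x hx
    -- The value `⊤` on the levels up to `m` makes the inequality trivial there, and `rateAbove`
    -- gives these levels no weight as targets.
    have h := mul_green_le_of_superharmonic (a := B.rateAbove m) h0 exitRate_ne_top
      (v := fun x => if m < x.1.1 then 1 else ⊤) (c := d) (y := y) (fun x => by
        split_ifs with h1 h2 h2
        · rw [mul_one, ← habove x h2, add_comm, if_pos h1]
          refine add_le_add_left (ENNReal.tsum_le_tsum fun z => ?_) _
          unfold rateAbove
          split_ifs <;> simp
        · rw [ENNReal.mul_top (h0 x)]
          exact le_top
        · rw [mul_one, ← habove x h2, if_neg h1, zero_add, add_zero]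
          refine ENNReal.tsum_le_tsum fun z => ?_
          unfold rateAbove
          split_ifs <;> simp
        · rw [ENNReal.mul_top (h0 x)]
          exact le_top) x
    rwa [if_pos hx] at h
  -- `g` is the probability of ever being in a level up to `m`. It will be harmonic by recurrence,
  -- and it touches the constant `1` at level `m`.
  set g : QSFState ℓ → ℝ≥0∞ := fun x => if m < x.1.1 then d * B.greenAbove m x y else 1 with hg
  have hg1 : ∀ x, g x ≤ 1 := fun x => by
    rw [hg]
    dsimp only
    split_ifs with h
    · exact hle x h
    · exact le_rfl
  have hone : ∀ x, ∑' z, a x z * (1 : ℝ≥0∞) = q x * 1 := fun x => by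
    simp only [mul_one]
    exact hB.tsum_offRate_generator x
  have hsup : ∀ x, ∑' z, a x z * g z ≤ q x * g x := by
    intro x
    by_cases hx : m < x.1.1
    · have e : ∀ z, a x z * g z = d * (B.rateAbove m x z * B.greenAbove m z y) +
          (if m < z.1.1 then 0 else a x z) := by
        intro z
        simp only [hg, rateAbove]
        split_ifs
        · ring
        · simp
      have hb := green_backward (a := B.rateAbove m) h0 exitRate_ne_top x y
      have h1 : ∑' z, (if m < z.1.1 then 0 else a x z) = if x = y then d else 0 := by
        have hne : ∑' z, B.rateAbove m x z ≠ ⊤ := by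
          refine ne_top_of_le_ne_top (exitRate_ne_top (Q := B.generator) x) ?_
          change _ ≤ q x
          rw [← habove x hx]
          exact le_self_add
        rw [← ENNReal.add_right_inj hne, habove x hx, ← ENNReal.tsum_add]
        refine (tsum_congr fun z => ?_).trans (hB.tsum_offRate_generator x)
        unfold rateAbove
        split_ifs <;> simp [a]
      rw [tsum_congr e, ENNReal.tsum_add, ENNReal.tsum_mul_left, h1]
      have hgx : g x = d * B.greenAbove m x y := if_pos hx
      rw [hgx, mul_left_comm, hb, mul_add, add_comm]
      refine le_of_eq ?_
      congr 1
      split_ifs <;> simp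
    · have hgx : g x = 1 := if_neg hx
      rw [hgx, ← hone x]
      exact ENNReal.tsum_le_tsum fun z => mul_le_mul_right (hg1 z) _
  have hharm := superharmonic_eq_of_recurrent h0 exitRate_ne_top hrec
    (fun x => ne_top_of_le_ne_top ENNReal.one_ne_top (hg1 x)) hsup
  have := harmonic_eq_of_eq_at exitRate_ne_top (fun _ => ENNReal.one_ne_top) hg1 hharm hone
    (ReflTransGen_offRate hB.irr (⟨m, hm.le⟩, Phase.zero ℓ) x) (if_neg (lt_irrefl m))
  exact (if_pos hx).symm.trans this

/-- The flow out of the levels above `m` equals the flow into them. -/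
lemma tsum_inflow_mul_greenAbove (hB : B.IsExitGenerator) (hrec : IsRecurrent B) {m : ℤ}
    (hm : m < 0) (p : QSFState ℓ → ℝ≥0∞) :
    (∑' x, B.inflow m p x * B.greenAbove m x (⟨m + 1, by omega⟩, Phase.zero ℓ)) *
      ENNReal.ofReal B.downRate = ∑' x, B.inflow m p x := by
  rw [← ENNReal.tsum_mul_right]
  refine tsum_congr fun x => ?_
  by_cases hx : m < x.1.1
  · rw [mul_assoc, mul_comm (B.greenAbove m x _), hB.downRate_mul_greenAbove hrec hm x hx, mul_one]
  · rw [inflow_eq_zero (not_lt.1 hx), zero_mul, zero_mul]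

/-- Above level `m`, `p` solves the forward equation with source `inflow`, and the Green function
gives its minimal solution. -/
lemma tsum_inflow_mul_greenAbove_le (hB : B.IsExitGenerator) {m : ℤ} {p : QSFState ℓ → ℝ≥0∞}
    (hp : ∀ y, ∑' x, p x * offRate B.generator x y = p y * exitRate B.generator y)
    (y : QSFState ℓ) (hy : m < y.1.1) :
    ∑' x, B.inflow m p x * B.greenAbove m x y ≤ p y := by
  have h := tsum_mul_green_le_of_superinvariant (a := B.rateAbove m)
    hB.exitRate_generator_ne_zero exitRate_ne_top (b := B.inflow m p)
    (v := fun y => if m < y.1.1 then p y else 0) (fun y => by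
      split_ifs with h
      · rw [inflow, ← ENNReal.tsum_add, ← hp y]
        refine ENNReal.tsum_le_tsum fun x => le_of_eq ?_
        rw [rateAbove, if_pos h]
        rcases lt_or_ge m x.1.1 with hx | hx
        · simp [hx, not_le.2 hx]
        · simp [hx, not_lt.2 hx]
      · simp [inflow_eq_zero (not_lt.1 h), rateAbove, h]) y
  rwa [if_pos hy] at h

variable (B) in
/-- The flow from the levels below `m` into the level `m`, directly or through higher levels. -/
noncomputable def levelInflow (m : ℤ) (p : QSFState ℓ → ℝ≥0∞) (j : Phase ℓ) : ℝ≥0∞ :=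
  ∑' x : subLevel ℓ (m - 1), p x.1 * ENNReal.ofReal (B.Acheck m x j)

lemma levelInflow_eq (hB : B.IsExitGenerator) {m : ℤ} (p : QSFState ℓ → ℝ≥0∞) (j : Phase ℓ) :
    levelInflow B m p j =
      ∑' x : subLevel ℓ (m - 1), p x.1 * ENNReal.ofReal (B.U (m - x.1.1.1).toNat x.1.2 j) +
      (∑' x : subLevel ℓ (m - 1),
        p x.1 * ENNReal.ofReal (B.upRate (m + 1 - x.1.1.1).toNat x.1.2)) *
        ENNReal.ofReal (B.entrance j) := by
  rw [levelInflow, ← ENNReal.tsum_mul_right, ← ENNReal.tsum_add]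
  refine tsum_congr fun x => ?_
  have hx : x.1.1.1 ≤ m - 1 := x.2
  have h1 : 1 ≤ (m - x.1.1.1).toNat := by omega
  have h2 : 1 ≤ (m + 1 - x.1.1.1).toNat := by omega
  rw [Acheck_eq, ENNReal.ofReal_add (hB.U_nonneg h1 _ _)
    (mul_nonneg (hB.upRate_nonneg h2 _) (hB.entrance_nonneg j)),
    ENNReal.ofReal_mul (hB.upRate_nonneg h2 _)]
  ring

/-- Regroups the flow into `(m, j)`: excursions from lower levels go into `Ǎ`, those from level `m`
into `Q̌`. Excursions from `(m, j)` to itself remain as the last term, since `offRate` omits the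
diagonal. -/
lemma level_balance (hB : B.IsExitGenerator) {m : ℤ} (hm : m < 0) (p : QSFState ℓ → ℝ≥0∞)
    (j : Phase ℓ) :
    ∑' x : subLevel ℓ (m - 1), p x.1 * ENNReal.ofReal (B.U (m - x.1.1.1).toNat x.1.2 j) +
      ∑' i, p (⟨m, hm.le⟩, i) * offRate B.W i j +
      (∑' y, B.inflow m p y) * ENNReal.ofReal (B.entrance j) =
    levelInflow B m p j + ∑' i, p (⟨m, hm.le⟩, i) * offRate B.Qcheck i j +
      p (⟨m, hm.le⟩, j) * (ENNReal.ofReal (B.upRate 1 j) * ENNReal.ofReal (B.entrance j)) := by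
  have e : ∑' i, p (⟨m, hm.le⟩, i) * offRate B.Qcheck i j +
      p (⟨m, hm.le⟩, j) * (ENNReal.ofReal (B.upRate 1 j) * ENNReal.ofReal (B.entrance j)) =
      ∑' i, p (⟨m, hm.le⟩, i) * offRate B.W i j +
      (∑' i, p (⟨m, hm.le⟩, i) * ENNReal.ofReal (B.upRate 1 i)) *
        ENNReal.ofReal (B.entrance j) := by
    rw [← ENNReal.tsum_mul_right, ← ENNReal.tsum_add, ← tsum_ite_eq j (fun i =>
      p (⟨m, hm.le⟩, i) * (ENNReal.ofReal (B.upRate 1 i) * ENNReal.ofReal (B.entrance j))),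
      ← ENNReal.tsum_add]
    refine tsum_congr fun i => ?_
    rw [mul_assoc, ← mul_add, ← hB.offRate_Qcheck i j, mul_add]
    simp only [eq_comm (a := i)]
    split_ifs with h
    · rw [h]
    · simp
  rw [add_assoc (levelInflow B m p j), e, hB.levelInflow_eq, hB.tsum_inflow hm, add_mul]
  ring

variable (B) in
/-- The candidate for the stationary measure on level `m`. -/
noncomputable def levelMeasure (m : ℤ) (p : QSFState ℓ → ℝ≥0∞) (j : Phase ℓ) : ℝ≥0∞ :=
  ∑' i, levelInflow B m p i * green (offRate B.Qcheck) (exitRate B.Qcheck) i j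

lemma tsum_flow_into_of_balance (hB : B.IsExitGenerator) {m : ℤ} (hm : m < 0)
    (p : QSFState ℓ → ℝ≥0∞)
    (hout : p (⟨m + 1, by omega⟩, Phase.zero ℓ) * ENNReal.ofReal B.downRate =
      ∑' y, B.inflow m p y) (j : Phase ℓ) :
    ∑' x, p x * offRate B.generator x (⟨m, hm.le⟩, j) =
      levelInflow B m p j + ∑' i, p (⟨m, hm.le⟩, i) * offRate B.Qcheck i j +
      p (⟨m, hm.le⟩, j) * (ENNReal.ofReal (B.upRate 1 j) * ENNReal.ofReal (B.entrance j)) := by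
  rw [← hB.level_balance hm, hB.tsum_flow_into hm, ← hout, mul_assoc,
    ← ENNReal.ofReal_mul hB.downRate_pos.le, hB.downRate_mul_entrance]

/-- The original process also leaves `(m, j)` for excursions that end in `(m, j)`; this extra term
cancels the last one in `level_balance`. -/
lemma exitRate_generator_level (hB : B.IsExitGenerator) {m : ℤ} (hm : m < 0) (j : Phase ℓ) :
    exitRate B.generator (⟨m, hm.le⟩, j) = exitRate B.Qcheck j +
      ENNReal.ofReal (B.upRate 1 j) * ENNReal.ofReal (B.entrance j) := by
  rw [hB.exitRate_Qcheck, exitRate,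
    B.generator_same (x := (⟨m, hm.le⟩, j)) (y := (⟨m, hm.le⟩, j)) rfl hm, exitRate]

/-- The downward flow from `(m+1,0)` is at least the flow generated by upward jumps, so `p` on level
`m` is superinvariant for `Q̌` with source `levelInflow`. -/
lemma levelMeasure_le (hB : B.IsExitGenerator) (hrec : IsRecurrent B) {m : ℤ} (hm : m < 0)
    {p : QSFState ℓ → ℝ≥0∞} (hpt : ∀ x, p x ≠ ⊤)
    (hp : ∀ y, ∑' x, p x * offRate B.generator x y = p y * exitRate B.generator y)
    (j : Phase ℓ) : levelMeasure B m p j ≤ p (⟨m, hm.le⟩, j) := by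
  refine tsum_mul_green_le_of_superinvariant (a := offRate B.Qcheck) hB.exitRate_Qcheck_ne_zero
    exitRate_ne_top (v := fun j => p (⟨m, hm.le⟩, j)) (fun j => ?_) j
  have hne : p (⟨m, hm.le⟩, j) *
      (ENNReal.ofReal (B.upRate 1 j) * ENNReal.ofReal (B.entrance j)) ≠ ⊤ :=
    ENNReal.mul_ne_top (hpt _) (ENNReal.mul_ne_top ENNReal.ofReal_ne_top ENNReal.ofReal_ne_top)
  rw [← ENNReal.add_le_add_iff_right hne, ← mul_add, ← hB.exitRate_generator_level hm, ← hp,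
    ← hB.level_balance hm, hB.tsum_flow_into hm, ← hB.tsum_inflow_mul_greenAbove hrec hm, mul_assoc,
    ← ENNReal.ofReal_mul hB.downRate_pos.le, hB.downRate_mul_entrance]
  gcongr
  exact hB.tsum_inflow_mul_greenAbove_le hp _ (by dsimp only; omega)

/-- An invariant measure is determined on level `m` by its values on the lower levels. -/
theorem eq_levelMeasure (hB : B.IsExitGenerator) (hrec : IsRecurrent B) {m : ℤ} (hm : m < 0)
    {p : QSFState ℓ → ℝ≥0∞} (hpt : ∀ x, p x ≠ ⊤)
    (hp : ∀ y, ∑' x, p x * offRate B.generator x y = p y * exitRate B.generator y)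
    (j : Phase ℓ) : p (⟨m, hm.le⟩, j) = levelMeasure B m p j := by
  -- `r` fixes the comparison measure `v` on the levels up to `m`; above them `v` is the sojourn
  -- measure fed by the upward flow of `r`.
  set r : QSFState ℓ → ℝ≥0∞ := fun x => if x.1.1 = m then levelMeasure B m p x.2 else p x with hr
  set v : QSFState ℓ → ℝ≥0∞ := fun x =>
    if m < x.1.1 then ∑' z, B.inflow m r z * B.greenAbove m z x else r x with hv
  have hv_above : ∀ x, m < x.1.1 → v x = ∑' z, B.inflow m r z * B.greenAbove m z x :=
    fun x hx => if_pos hx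
  have hv_le : ∀ x, x.1.1 ≤ m → v x = r x := fun x hx => if_neg (not_lt.2 hx)
  have hv_below : ∀ x, x.1.1 < m → v x = p x := fun x hx => by
    rw [hv_le x hx.le]
    exact if_neg hx.ne
  have hv_level : ∀ i, v (⟨m, hm.le⟩, i) = levelMeasure B m p i := fun i => by
    rw [hv_le _ le_rfl]
    exact if_pos rfl
  have hrp : ∀ x, x.1.1 ≤ m → r x ≤ p x := by
    rintro ⟨⟨k, hk⟩, i⟩ hx
    rw [hr]
    dsimp only
    split_ifs with h
    · subst h
      exact hB.levelMeasure_le hrec hm hpt hp i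
    · exact le_rfl
  have hvp : ∀ x, v x ≤ p x := by
    intro x
    rcases le_or_gt x.1.1 m with hx | hx
    · rw [hv_le x hx]
      exact hrp x hx
    · rw [hv_above x hx]
      refine le_trans ?_ (hB.tsum_inflow_mul_greenAbove_le hp x hx)
      exact ENNReal.tsum_le_tsum fun z => mul_le_mul_left (inflow_mono hrp z) _
  have hinflow : ∀ y, B.inflow m v y = B.inflow m r y := fun y => le_antisymm
    (inflow_mono (fun x hx => (hv_le x hx).le) y) (inflow_mono (fun x hx => (hv_le x hx).ge) y)
  have hlev : ∀ i, levelInflow B m v i = levelInflow B m p i := fun i => by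
    refine tsum_congr fun x => ?_
    have hx : x.1.1.1 ≤ m - 1 := x.2
    rw [hv_below x.1 (by omega)]
  -- Below level `m` only the domination by `p` is used. On level `m` and above it the forward
  -- equations give equality.
  have hsup : ∀ y, ∑' x, v x * offRate B.generator x y ≤ v y * exitRate B.generator y := by
    rintro ⟨⟨k, hk⟩, i⟩
    rcases lt_trichotomy k m with h | rfl | h
    · rw [hv_below _ h, ← hp]
      exact ENNReal.tsum_le_tsum fun x => mul_le_mul_left (hvp x) _
    · have hout : v (⟨k + 1, by omega⟩, Phase.zero ℓ) * ENNReal.ofReal B.downRate =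
          ∑' y, B.inflow k v y := by
        rw [hv_above _ (by dsimp only; omega), hB.tsum_inflow_mul_greenAbove hrec hm]
        simp only [hinflow]
      have hf := tsum_mul_green_forward (a := offRate B.Qcheck) hB.exitRate_Qcheck_ne_zero
        exitRate_ne_top (levelInflow B k p) i
      rw [hB.tsum_flow_into_of_balance hm v hout, hB.exitRate_generator_level hm, mul_add, hlev]
      simp only [hv_level]
      rw [levelMeasure, hf]
      rfl
    · have hf := tsum_mul_green_forward (a := B.rateAbove m) hB.exitRate_generator_ne_zero
        exitRate_ne_top (B.inflow m r)
      -- The source vanishes on the levels up to `m` and `rateAbove` never enters them.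
      have hzero : ∀ z : QSFState ℓ, z.1.1 ≤ m →
          ∑' x, B.inflow m r x * B.greenAbove m x z = 0 := by
        intro z hz
        have := hf z
        rw [inflow_eq_zero hz] at this
        simp only [rateAbove, not_lt.2 hz, if_false, mul_zero, tsum_zero, add_zero] at this
        exact (mul_eq_zero.1 this).resolve_right (hB.exitRate_generator_ne_zero z)
      rw [hv_above _ h, hf, inflow, ← ENNReal.tsum_add]
      refine ENNReal.tsum_le_tsum fun x => le_of_eq ?_
      rw [← add_mul, rateAbove, if_pos h]
      congr 1
      rcases le_or_gt x.1.1 m with hx | hx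
      · rw [if_pos hx, hzero x hx, add_zero, hv_le x hx]
      · rw [if_neg (not_le.2 hx), zero_add, hv_above x hx]
  have hinv := superinvariant_eq_of_recurrent hB.exitRate_generator_ne_zero exitRate_ne_top hrec
    (fun x => ne_top_of_le_ne_top (hpt x) (hvp x)) hsup
  rw [← hv_level j]
  refine (invariant_eq_of_eq_at exitRate_ne_top hpt hvp hinv hp (ReflTransGen_offRate hB.irr
    (⟨m, hm.le⟩, j) (⟨m - 1, by omega⟩, Phase.zero ℓ)) (hv_below _ ?_)).symm
  dsimp only
  omega

/-! ### Recurrence and the rate matrix `R` -/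

lemma isRecurrent_of_stationary (hB : B.IsExitGenerator) {p : QSFState ℓ → ℝ}
    (hp : IsStationaryDistribution B.generator p) : IsRecurrent B := by
  intro y
  refine stationary_recurrent hB.generator_diag_nonpos hB.exitRate_generator_ne_zero
    (fun x => (hB.tsum_offRate_generator x).le) hp y ?_
  obtain ⟨x, hx⟩ : ∃ x, ENNReal.ofReal (p x) ≠ 0 := by
    by_contra! h
    have h0 : ∀ x, p x = 0 := fun x => le_antisymm (ENNReal.ofReal_eq_zero.1 (h x)) (hp.1 x)
    have h1 := hp.2.1
    simp only [funext h0] at h1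
    exact zero_ne_one (hasSum_zero.unique h1)
  -- Some state carries mass, and invariance transports positive mass along paths to every state.
  exact invariant_ne_zero (v := fun x => ENNReal.ofReal (p x))
    (stationary_invariant hB.generator_diag_nonpos hp) (ReflTransGen_offRate hB.irr x y) hx

lemma meanSojourn_Qcheck (hB : B.IsExitGenerator) (i j : Phase ℓ) :
    meanSojourn B.Qcheck i j = green (offRate B.Qcheck) (exitRate B.Qcheck) i j :=
  meanSojourn_eq_green hB.Qcheck_diag_nonpos i j

lemma Acheck_nonneg (hB : B.IsExitGenerator) {m : ℤ} (x : subLevel ℓ (m - 1)) (j : Phase ℓ) :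
    0 ≤ B.Acheck m x j := by
  have hx : x.1.1.1 ≤ m - 1 := x.2
  rw [Acheck_eq]
  exact add_nonneg (hB.U_nonneg (by omega) _ _)
    (mul_nonneg (hB.upRate_nonneg (by omega) _) (hB.entrance_nonneg j))

lemma summable_Acheck (hB : B.IsExitGenerator) {m : ℤ} (hm : m < 0) (x : subLevel ℓ (m - 1)) :
    Summable (B.Acheck m x) := by
  have hx : x.1.1.1 ≤ m - 1 := x.2
  have h := (hB.summable_row x.1 ⟨m, hm.le⟩).add
    (hB.hasSum_entrance.summable.mul_left (B.upRate (m + 1 - x.1.1.1).toNat x.1.2))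
  refine h.congr fun j => ?_
  rw [Acheck_eq, B.generator_up (by dsimp only; omega) hm]

/-- The rows of `Ǎ` are summable, and each column of the Green function is bounded by its diagonal
entry. -/
lemma summable_Acheck_mul (hB : B.IsExitGenerator) {m : ℤ} (hm : m < 0) (x : subLevel ℓ (m - 1))
    (j : Phase ℓ) : Summable fun i => B.Acheck m x i * (meanSojourn B.Qcheck i j).toReal := by
  refine Summable.of_nonneg_of_le (fun i => mul_nonneg (hB.Acheck_nonneg x i) ENNReal.toReal_nonneg)
    (fun i => mul_le_mul_of_nonneg_left ?_ (hB.Acheck_nonneg x i))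
    ((hB.summable_Acheck hm x).mul_right (meanSojourn B.Qcheck j j).toReal)
  simp only [hB.meanSojourn_Qcheck]
  refine ENNReal.toReal_mono (hB.green_Qcheck_ne_top j j) (green_le_diag hB.exitRate_Qcheck_ne_zero
    exitRate_ne_top (fun x => ?_) i j)
  rw [← hB.tsum_offRate_Qcheck x]
  exact le_self_add

lemma rateMatrix_eq (m : ℤ) (x : subLevel ℓ (m - 1)) (j : Phase ℓ) :
    B.rateMatrix m x j = ∑' i, B.Acheck m x i * (meanSojourn B.Qcheck i j).toReal := by
  simp only [rateMatrix, qInverse, mul_neg, tsum_neg, neg_neg]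

lemma ofReal_rateMatrix (hB : B.IsExitGenerator) {m : ℤ} (hm : m < 0) (x : subLevel ℓ (m - 1))
    (j : Phase ℓ) : ENNReal.ofReal (B.rateMatrix m x j) =
      ∑' i, ENNReal.ofReal (B.Acheck m x i) *
        green (offRate B.Qcheck) (exitRate B.Qcheck) i j := by
  rw [rateMatrix_eq, ENNReal.ofReal_tsum_of_nonneg
    (fun i => mul_nonneg (hB.Acheck_nonneg x i) ENNReal.toReal_nonneg)
    (hB.summable_Acheck_mul hm x j)]
  refine tsum_congr fun i => ?_
  rw [ENNReal.ofReal_mul (hB.Acheck_nonneg x i), hB.meanSojourn_Qcheck,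
    ENNReal.ofReal_toReal (hB.green_Qcheck_ne_top i j)]

lemma hasSum_rateMatrix (hB : B.IsExitGenerator) {p : QSFState ℓ → ℝ}
    (hp : IsStationaryDistribution B.generator p) {m : ℤ} (hm : m < 0) (j : Phase ℓ) :
    HasSum (fun x : subLevel ℓ (m - 1) => p x.1 * B.rateMatrix m x j) (p (⟨m, hm.le⟩, j)) := by
  have hR : ∀ x : subLevel ℓ (m - 1), 0 ≤ p x.1 * B.rateMatrix m x j := fun x => by
    refine mul_nonneg (hp.1 _) ?_
    rw [rateMatrix_eq]
    exact tsum_nonneg fun i => mul_nonneg (hB.Acheck_nonneg x i) ENNReal.toReal_nonneg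
  -- In `ℝ≥0∞` Tonelli reassociates `(π̃ Ǎ) Ť` as `π̃ (Ǎ Ť)`; only afterwards is the identity moved
  -- to `ℝ`.
  have key : ∑' x : subLevel ℓ (m - 1), ENNReal.ofReal (p x.1 * B.rateMatrix m x j) =
      ENNReal.ofReal (p (⟨m, hm.le⟩, j)) := by
    rw [hB.eq_levelMeasure (hB.isRecurrent_of_stationary hp) hm
      (p := fun x => ENNReal.ofReal (p x)) (fun x => ENNReal.ofReal_ne_top)
      (stationary_invariant hB.generator_diag_nonpos hp) j]
    simp only [levelMeasure, levelInflow, ← ENNReal.tsum_mul_right]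
    rw [ENNReal.tsum_comm]
    refine tsum_congr fun x => ?_
    rw [ENNReal.ofReal_mul (hp.1 _), hB.ofReal_rateMatrix hm, ← ENNReal.tsum_mul_left]
    simp only [mul_assoc]
  have h := ENNReal.hasSum_toReal (key.trans_ne ENNReal.ofReal_ne_top)
  rw [← ENNReal.tsum_toReal_eq (fun _ => ENNReal.ofReal_ne_top), key,
    ENNReal.toReal_ofReal (hp.1 _)] at h
  exact h.congr_fun fun x => (ENNReal.toReal_ofReal (hR x)).symm

end IsExitGenerator

end QSFBlocks

theorem mainTheorem3 (ℓ : ℕ∞) (B : QSFBlocks ℓ)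
    (hcons : IsConservativeQMatrix B.generator)
    (hhom : B.HomogeneousConservative)
    (hirr : IsIrreducibleQMatrix B.generator)
    (hexit : ∀ (m : ℤ) (hm : m ≤ 0),
      IsExitState B.generator (QSFBlocks.superLevel ℓ m) (⟨m, hm⟩, Phase.zero ℓ))
    (p : QSFState ℓ → ℝ) (hp : IsStationaryDistribution B.generator p) :
    (∀ i j, meanSojourn B.Qcheck i j ≠ ⊤) ∧
    IsMatrixInverse B.Qcheck (qInverse B.Qcheck) ∧
    (ℓ ≠ ⊤ → ∀ N, IsMatrixInverse B.Qcheck N → N = qInverse B.Qcheck) ∧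
    ∀ (m : ℤ) (hm : m < 0) (j : Phase ℓ),
      (∀ x : QSFBlocks.subLevel ℓ (m - 1),
        Summable (fun i => B.Acheck m x i * qInverse B.Qcheck i j)) ∧
      HasSum (fun x : QSFBlocks.subLevel ℓ (m - 1) => p x.1 * B.rateMatrix m x j)
        (p (⟨m, hm.le⟩, j)) := by
  have hB : B.IsExitGenerator := ⟨hcons, hhom, hirr, hexit⟩
  have hfin : ∀ i j, meanSojourn B.Qcheck i j ≠ ⊤ := fun i j => by
    rw [hB.meanSojourn_Qcheck]
    exact hB.green_Qcheck_ne_top i j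
  have hinv : IsMatrixInverse B.Qcheck (qInverse B.Qcheck) :=
    isMatrixInverse_qInverse hB.Qcheck_diag_nonpos (fun x y => hB.Qcheck_nonneg)
      hB.exitRate_Qcheck_ne_zero hfin
  refine ⟨hfin, hinv, fun hl N hN => ?_, fun m hm j => ⟨fun x => ?_, hB.hasSum_rateMatrix hp hm j⟩⟩
  · obtain ⟨n, rfl⟩ := ENat.ne_top_iff_exists.1 hl
    have : Finite (Phase (n : ℕ∞)) :=
      Set.Finite.subset (Set.finite_Iic n) fun i (hi : (i : ℕ∞) ≤ n) => by exact_mod_cast hi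
    exact hN.eq_of_finite hinv
  · simp only [qInverse, mul_neg]
    exact (hB.summable_Acheck_mul hm x j).neg
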